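/- Let $\alpha\in(0,2)$, $\lambda_+,\lambda_->0$, $\mu,\beta\in\mathbb R$ and $a,b>0$. For tempering parameters $\ell_+,\ell_->0$, let $\mathrm{stdCTS}(\alpha,\ell_+,\ell_-)$ be the standardized classical tempered stable law, i.e. the law with characteristic function $$t\mapsto\exp\int_{\mathbb R}(e^{itx}-1-itx)\,C\Big(\frac{e^{-\ell_+x}}{x^{1+\alpha}}\mathbf 1_{x>0}+\frac{e^{-\ell_-|x|}}{|x|^{1+\alpha}}\mathbf 1_{x<0}\Big)dx,\qquad C=\frac{1}{\Gamma(2-\alpha)(\ell_+^{\alpha-2}+\ell_-^{\alpha-2})}.$$ Let $Y\sim MixedTS(\mu,\beta,\alpha,\lambda_+,\lambda_-)-\Gamma(a,b)$, i.e. $Y$ has the law of $\mu+\beta V+\sqrt V X$, where $V$ has the Gamma law with shape $a$ and rate $b$ and, conditionally on $V$, $X\sim \mathrm{stdCTS}(\alpha,\lambda_+\sqrt V,\lambda_-\sqrt V)$. For $u\in[-\lambda_-,\lambda_+]$ put $$\Phi_H(u)=\frac{(\lambda_+-u)^\alpha-\lambda_+^\alpha+(\lambda_-+u)^\alpha-\lambda_-^\alpha}{\alpha(\alpha-1)(\lambda_+^{\alpha-2}+\lambda_-^{\alpha-2})}+\frac{(\lambda_+^{\alpha-1}-\lambda_-^{\alpha-1})u}{(\alpha-1)(\lambda_+^{\alpha-2}+\lambda_-^{\alpha-2})}\quad(\alpha\ne1),$$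 and, for $\alpha=1$, let $\Phi_H$ be the limit of this expression, $$\Phi_H(u)=\frac{(\lambda_+-u)\log\frac{\lambda_+-u}{\lambda_+}+(\lambda_-+u)\log\frac{\lambda_-+u}{\lambda_-}}{\lambda_+^{-1}+\lambda_-^{-1}}\qquad(0\log0=0).$$ Let $G(u)=\beta u+\Phi_H(u)$, and let $r^\star=\sup\{u\in\mathbb R: E[e^{uY}]<\infty\}$ and $-q^\star=\inf\{u\in\mathbb R:E[e^{uY}]<\infty\}$. Then $r^\star,q^\star\in(0,\infty)$ and: 1. If $G(\lambda_+)\le b$, then $r^\star=\lambda_+$. If $G(\lambda_+)>b$, then $r^\star=u_+$, where $u_+\in(0,\lambda_+)$ is a solution of $G(u)=b$. 2. If $G(-\lambda_-)\le b$, then $q^\star=\lambda_-$. If $G(-\lambda_-)>b$, then $q^\star=-u_-$, where $u_-\in(-\lambda_-,0)$ is a solution of $G(u)=b$. 3. The equation $G(u)=b$ has no solutions in $[-\lambda_-,\lambda_+]$ other than, possibly, $r^\star$ and $-q^\star$; in particular $u_+$ and $u_-$ are unique. 4. The tails of $Y$ are log-exponential: as $x\to+\infty$, $$\log P(Y>x)\sim-r^\star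 x,\qquad \log P(Y\le-x)\sim-q^\star x.$$ -/

import Mathlib

open MeasureTheory ProbabilityTheory Filter Asymptotics

noncomputable section

/-- Lévy density of the classical tempered stable law `CTS(α, lp, lm, Cp, Cm, m)`:
`Cp * exp (-lp * x) / x ^ (1 + α)` for `x > 0` and
`Cm * exp (-lm * |x|) / |x| ^ (1 + α)` for `x < 0`. -/
def ctsLevyDensity (α lp lm Cp Cm x : ℝ) : ℝ :=
  if 0 < x then Cp * Real.exp (-lp * x) / x ^ (1 + α)
  else if x < 0 then Cm * Real.exp (-lm * |x|) / |x| ^ (1 + α)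
  else 0

/-- Characteristic exponent of `CTS(α, lp, lm, Cp, Cm, m)`, in Lévy–Khintchine form with full
compensation of the jumps, so that `m` is the mean. -/
def ctsCharExponent (α lp lm Cp Cm m t : ℝ) : ℂ :=
  Complex.I * t * m +
    ∫ x : ℝ, (Complex.exp (Complex.I * t * x) - 1 - Complex.I * t * x) *
      (ctsLevyDensity α lp lm Cp Cm x : ℂ)

/-- `ρ` is the classical tempered stable law `CTS(α, lp, lm, Cp, Cm, m)`. -/
structure IsCTS (α lp lm Cp Cm m : ℝ) (ρ : Measure ℝ) : Prop where
  isProbabilityMeasure : IsProbabilityMeasure ρ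
  charFun_eq : ∀ t : ℝ, charFun ρ t = Complex.exp (ctsCharExponent α lp lm Cp Cm m t)

/-- The constant that normalizes the variance of a tempered stable law to one. -/
def stdCTSConst (α lp lm : ℝ) : ℝ :=
  1 / (Real.Gamma (2 - α) * (lp ^ (α - 2) + lm ^ (α - 2)))

/-- `ρ` is the standardized (mean zero, variance one) tempered stable law
`stdCTS(α, lp, lm)`. -/
def IsStdCTS (α lp lm : ℝ) (ρ : Measure ℝ) : Prop :=
  IsCTS α lp lm (stdCTSConst α lp lm) (stdCTSConst α lp lm) 0 ρ

/-- `ρ` is the law `MixedTS(μ, β, α, lp, lm) - F`, that is, the law of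
`μ + β V + √V X`, where `V` is positive with law `F` and, conditionally on `V = v`, the variable
`X` has law `stdCTS(α, lp √v, lm √v)`. The kernel `κ` is the conditional law of `X` given `V`, so
that `F ⊗ₘ κ` is the joint law of `(V, X)`. -/
def IsMixedTS (μ β α lp lm : ℝ) (F ρ : Measure ℝ) : Prop :=
  (∀ᵐ v ∂F, 0 < v) ∧
  ∃ κ : Kernel ℝ ℝ, IsMarkovKernel κ ∧
    (∀ᵐ v ∂F, IsStdCTS α (lp * √v) (lm * √v) (κ v)) ∧
    ρ = (F ⊗ₘ κ).map (fun p : ℝ × ℝ => μ + β * p.1 + √p.1 * p.2)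

/-- The cumulant generating function `Φ_H` of `H ∼ stdCTS(α, lp, lm)` on `[-lm, lp]`. For `α = 1`
it is the limit of the expression for `α ≠ 1`. -/
def PhiH (α lp lm u : ℝ) : ℝ :=
  if α = 1 then
    ((lp - u) * Real.log ((lp - u) / lp) + (lm + u) * Real.log ((lm + u) / lm)) /
      (lp⁻¹ + lm⁻¹)
  else
    ((lp - u) ^ α - lp ^ α + (lm + u) ^ α - lm ^ α) /
        (α * (α - 1) * (lp ^ (α - 2) + lm ^ (α - 2))) +
      (lp ^ (α - 1) - lm ^ (α - 1)) * u / ((α - 1) * (lp ^ (α - 2) + lm ^ (α - 2)))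

end


/-!
Let `N` be the Lévy measure of `stdCTS(α, lp, lm)`, whose Laplace exponent is `Φ_H`. By scaling,
`√v X` given `V = v` is centred infinitely divisible with Lévy measure `v N`: conditionally on `V`,
`Y - μ - β V` is a Lévy process run for time `V`. Hence `E[e^{uY}]` is at most
`e^{uμ} E[e^{G(u) V}]`, which is finite as soon as `G(u) < b`. As `G` is convex with `G(0) = 0 < b`,
it stays below `b` up to its unique positive root, or up to the endpoint `lp` if there is none.

Exponential Chebyshev bounds turn finiteness of `E[e^{uY}]` for `u < r` into the upper bound for
the right tail, so it remains to show that the tail decays no faster than at rate `r`. If `r = lp`,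
one big jump is enough, as `N(x, ∞)` decays at rate `lp`. If `G(r) = b` with `r < lp`, a large value
is most cheaply reached through a large `V`: let `m` be the slope of `G` at `r`, positive by
convexity. Given `V = v`, tilting by `r` makes `Y` of order `m v` at the price `e^{-(r m - b) v}`,
and `V ≈ v` has price `e^{-b v}`, which in total is rate `r` per unit of `Y`. Both bounds on
infinitely divisible laws are obtained for compound Poisson laws and pass to the limit as the
truncation of small jumps is removed.

The left tail of `Y` is the right tail of `-Y`, where `β` changes sign and `lp`, `lm` are swapped.
-/

section DecayRate

open scoped ENNReal Topology

/-- `f` decays at infinity at exponential rate at most `p`: it eventually dominates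
`exp (-q * x)` for every `q > p`. -/
def DecayRateLE (f : ℝ → ℝ≥0∞) (p : ℝ) : Prop :=
  ∀ q, p < q → ∀ᶠ x in atTop, ENNReal.ofReal (Real.exp (-q * x)) ≤ f x

namespace DecayRateLE

variable {f g : ℝ → ℝ≥0∞} {p q : ℝ}

lemma mono (hf : DecayRateLE f p) (h : ∀ᶠ x in atTop, f x ≤ g x) : DecayRateLE g p :=
  fun q hq => ((hf q hq).and h).mono fun _ hx => hx.1.trans hx.2

lemma of_forall_gt (h : ∀ q, p < q → DecayRateLE f q) : DecayRateLE f p := by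
  intro q hq
  obtain ⟨r, hpr, hrq⟩ := exists_between hq
  exact h r hpr q hrq

lemma exp_neg_mul : DecayRateLE (fun x => ENNReal.ofReal (Real.exp (-p * x))) p := by
  intro q hq
  filter_upwards [eventually_ge_atTop 0] with x hx
  gcongr

lemma mul (hf : DecayRateLE f p) (hg : DecayRateLE g q) :
    DecayRateLE (fun x => f x * g x) (p + q) := by
  intro s hs
  have hp : p < p + (s - (p + q)) / 2 := by linarith
  have hq : q < q + (s - (p + q)) / 2 := by linarith
  filter_upwards [hf _ hp, hg _ hq] with x hfx hgx
  refine le_of_eq_of_le ?_ (mul_le_mul' hfx hgx)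
  rw [← ENNReal.ofReal_mul (Real.exp_pos _).le, ← Real.exp_add]
  ring_nf

lemma const {c : ℝ≥0∞} (hc : c ≠ 0) : DecayRateLE (fun _ => c) 0 := by
  intro q hq
  have hlim : Tendsto (fun x : ℝ => ENNReal.ofReal (Real.exp (-q * x))) atTop (𝓝 0) := by
    have hexp : Tendsto (fun x : ℝ => Real.exp (-q * x)) atTop (𝓝 0) :=
      Real.tendsto_exp_atBot.comp (tendsto_id.const_mul_atTop_of_neg (by linarith))
    simpa using ENNReal.tendsto_ofReal hexp
  exact (hlim.eventually_lt_const hc.bot_lt).mono fun _ hx => hx.le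

lemma const_mul (hf : DecayRateLE f p) {c : ℝ≥0∞} (hc : c ≠ 0) :
    DecayRateLE (fun x => c * f x) p := by
  simpa using (const hc).mul hf

lemma comp_affine (hf : DecayRateLE f p) {d : ℝ} (hd : 0 < d) (k : ℝ) :
    DecayRateLE (fun x => f (d * x + k)) (p * d) := by
  intro q hq
  obtain ⟨s, hps, hsq⟩ := exists_between ((lt_div_iff₀ hd).2 hq)
  rw [lt_div_iff₀ hd] at hsq
  have hlim : Tendsto (fun x => d * x + k) atTop atTop :=
    tendsto_atTop_add_const_right _ _ (tendsto_id.const_mul_atTop hd)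
  have hlin : ∀ᶠ x in atTop, s * k ≤ (q - s * d) * x :=
    (tendsto_id.const_mul_atTop (sub_pos.2 hsq)).eventually_ge_atTop _
  filter_upwards [hlim.eventually (hf s hps), hlin] with x hfx hx
  exact (ENNReal.ofReal_le_ofReal (Real.exp_le_exp.2 (by linarith))).trans hfx

lemma comp_add_const (hf : DecayRateLE f p) (k : ℝ) : DecayRateLE (fun x => f (x + k)) p := by
  simpa using hf.comp_affine one_pos k

lemma const_mul_rpow_mul_exp {c : ℝ} (hc : 0 < c) (s : ℝ) :
    DecayRateLE (fun x => ENNReal.ofReal (c * (x ^ s * Real.exp (-p * x)))) p := by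
  intro q hq
  have hlim := tendsto_exp_mul_div_rpow_atTop (-s) (q - p) (sub_pos.2 hq)
  filter_upwards [hlim.eventually_ge_atTop c⁻¹, eventually_gt_atTop 0] with x hx hx0
  gcongr
  rw [Real.rpow_neg hx0.le, div_inv_eq_mul, inv_le_iff_one_le_mul₀ hc] at hx
  calc Real.exp (-q * x) ≤ Real.exp ((q - p) * x) * x ^ s * c * Real.exp (-q * x) :=
        le_mul_of_one_le_left (Real.exp_pos _).le hx
    _ = c * (x ^ s * (Real.exp ((q - p) * x) * Real.exp (-q * x))) := by ring
    _ = c * (x ^ s * Real.exp (-p * x)) := by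
        rw [← Real.exp_add]
        ring_nf

lemma withDensity_Icc (hf : DecayRateLE f p) :
    DecayRateLE (fun w => (volume.withDensity f) (Set.Icc w (w + 1))) p := by
  refine of_forall_gt fun q hq => ?_
  refine (exp_neg_mul.const_mul (c := ENNReal.ofReal (Real.exp (-|q|))) ?_).mono ?_
  · exact (ENNReal.ofReal_pos.2 (Real.exp_pos _)).ne'
  · filter_upwards [eventually_forall_ge_atTop.2 (hf q hq)] with w hw
    rw [withDensity_apply _ measurableSet_Icc, ← ENNReal.ofReal_mul (Real.exp_pos _).le,
      ← Real.exp_add]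
    have hvol : volume (Set.Icc w (w + 1)) = 1 := by simp
    rw [← mul_one (ENNReal.ofReal _), ← hvol, ← setLIntegral_const]
    refine setLIntegral_mono' measurableSet_Icc fun y hy => le_trans ?_ (hw y hy.1)
    gcongr
    nlinarith [hy.1, hy.2, neg_abs_le q, le_abs_self q]

lemma measure_Ioi {ρ : Measure ℝ} (h : DecayRateLE (fun w => ρ (Set.Icc w (w + 1))) p) :
    DecayRateLE (fun x => ρ (Set.Ioi x)) p :=
  (h.comp_add_const 1).mono <| Eventually.of_forall fun x =>
    measure_mono fun _ hy => (lt_add_one x).trans_le hy.1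

lemma isEquivalent_log (hf : DecayRateLE f p) (hp : 0 < p)
    (hub : ∀ u ∈ Set.Ioo 0 p, ∃ M ≠ ∞, ∀ x, f x ≤ M * ENNReal.ofReal (Real.exp (-u * x))) :
    (fun x => Real.log (f x).toReal) ~[atTop] fun x => -p * x := by
  refine isLittleO_iff.2 fun c hc => ?_
  obtain ⟨δ, hδ, hδc⟩ := exists_between (lt_min hc one_pos)
  obtain ⟨hδc, hδ1⟩ := lt_min_iff.1 hδc
  obtain ⟨M, hM, hfM⟩ := hub (p * (1 - δ)) ⟨by nlinarith, by nlinarith⟩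
  have hlin : ∀ᶠ x in atTop, Real.log M.toReal ≤ p * (c - δ) * x :=
    (tendsto_id.const_mul_atTop (mul_pos hp (sub_pos.2 hδc))).eventually_ge_atTop _
  filter_upwards [hf (p * (1 + c)) (by nlinarith), hlin, eventually_gt_atTop 0]
    with x hlow hlin hx
  have hfx_top : f x ≠ ∞ := ne_top_of_le_ne_top (by finiteness) (hfM x)
  have hlow : Real.exp (-(p * (1 + c)) * x) ≤ (f x).toReal :=
    (ENNReal.ofReal_le_iff_le_toReal hfx_top).1 hlow
  have hpos : 0 < (f x).toReal := (Real.exp_pos _).trans_le hlow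
  have hupp : (f x).toReal ≤ M.toReal * Real.exp (-(p * (1 - δ)) * x) := by
    have := ENNReal.toReal_mono (by finiteness) (hfM x)
    rwa [ENNReal.toReal_mul, ENNReal.toReal_ofReal (Real.exp_pos _).le] at this
  have hM_pos : 0 < M.toReal := pos_of_mul_pos_left (hpos.trans_le hupp) (Real.exp_pos _).le
  have hlog_low : -(p * (1 + c)) * x ≤ Real.log (f x).toReal := (Real.le_log_iff_exp_le hpos).2 hlow
  have hlog_upp : Real.log (f x).toReal ≤ Real.log M.toReal + -(p * (1 - δ)) * x := by
    rw [← Real.log_exp (-(p * (1 - δ)) * x), ← Real.log_mul hM_pos.ne' (Real.exp_pos _).ne']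
    exact Real.log_le_log hpos hupp
  rw [Pi.sub_apply, Real.norm_eq_abs, Real.norm_eq_abs, neg_mul, abs_neg,
    abs_of_pos (mul_pos hp hx), abs_le]
  constructor <;> linarith

end DecayRateLE

end DecayRate

noncomputable section ExtendedMGF

open scoped ENNReal Topology

/-- The moment generating function of `ρ` as an extended nonnegative real, so that divergence is
recorded as `∞` (whereas `mgf` takes the junk value `0`). -/
def lmgf (ρ : Measure ℝ) (u : ℝ) : ℝ≥0∞ := ∫⁻ y, ENNReal.ofReal (Real.exp (u * y)) ∂ρ

variable {ρ : Measure ℝ} {u : ℝ}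

lemma lmgf_zero_right (ρ : Measure ℝ) : lmgf ρ 0 = ρ Set.univ := by
  simp [lmgf]

lemma lmgf_ne_top_iff_integrable :
    lmgf ρ u ≠ ∞ ↔ Integrable (fun y => Real.exp (u * y)) ρ :=
  lintegral_ofReal_ne_top_iff_integrable (by fun_prop) (ae_of_all _ fun _ => (Real.exp_pos _).le)

lemma lmgf_map_ne_top_iff_integrable {Ω : Type*} [MeasurableSpace Ω] {P : Measure Ω} {Y : Ω → ℝ}
    (hY : AEMeasurable Y P) :
    lmgf (P.map Y) u ≠ ∞ ↔ Integrable (fun ω => Real.exp (u * Y ω)) P :=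
  lmgf_ne_top_iff_integrable.trans (integrable_map_measure (by fun_prop) hY)

lemma ofReal_integral_exp_eq_lmgf (h : Integrable (fun y => Real.exp (u * y)) ρ) :
    ENNReal.ofReal (∫ y, Real.exp (u * y) ∂ρ) = lmgf ρ u :=
  ofReal_integral_eq_lintegral_ofReal h (ae_of_all _ fun _ => (Real.exp_pos _).le)

lemma lmgf_conv (ρ τ : Measure ℝ) [SFinite τ] (u : ℝ) :
    lmgf (ρ ∗ τ) u = lmgf ρ u * lmgf τ u := by
  simp only [lmgf]
  rw [Measure.lintegral_conv (by fun_prop), ← lintegral_mul_const _ (by fun_prop)]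
  refine lintegral_congr fun x => ?_
  rw [← lintegral_const_mul _ (by fun_prop)]
  refine lintegral_congr fun y => ?_
  rw [← ENNReal.ofReal_mul (Real.exp_pos _).le, ← Real.exp_add, mul_add]

lemma lmgf_map_affine (ρ : Measure ℝ) (s c u : ℝ) :
    lmgf (ρ.map fun y => c + s * y) u = ENNReal.ofReal (Real.exp (u * c)) * lmgf ρ (u * s) := by
  rw [lmgf, lmgf, lintegral_map (by fun_prop) (by fun_prop), ← lintegral_const_mul _ (by fun_prop)]
  refine lintegral_congr fun y => ?_
  rw [← ENNReal.ofReal_mul (Real.exp_pos _).le, ← Real.exp_add]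
  ring_nf

lemma lmgf_map_add_const (ρ : Measure ℝ) (c u : ℝ) :
    lmgf (ρ.map (· + c)) u = ENNReal.ofReal (Real.exp (u * c)) * lmgf ρ u := by
  simpa [add_comm] using lmgf_map_affine ρ 1 c u

lemma lmgf_neg (ρ : Measure ℝ) (u : ℝ) : lmgf ρ.neg u = lmgf ρ (-u) := by
  have h := lmgf_map_affine ρ (-1) 0 u
  simpa [Measure.neg, Function.comp_def] using h

lemma measure_Ici_le_lmgf (ρ : Measure ℝ) (hu : 0 ≤ u) (x : ℝ) :
    ρ (Set.Ici x) ≤ lmgf ρ u * ENNReal.ofReal (Real.exp (-u * x)) := by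
  rw [lmgf, ← lintegral_mul_const _ (by fun_prop), ← setLIntegral_one]
  refine (setLIntegral_mono' measurableSet_Ici fun y hy => ?_).trans (setLIntegral_le_lintegral _ _)
  rw [← ENNReal.ofReal_mul (Real.exp_pos _).le, ← Real.exp_add, ← ENNReal.ofReal_one]
  refine ENNReal.ofReal_le_ofReal (Real.one_le_exp ?_)
  nlinarith [Set.mem_Ici.1 hy]

lemma measure_Iic_le_lmgf (ρ : Measure ℝ) (hu : 0 ≤ u) (x : ℝ) :
    ρ (Set.Iic x) ≤ lmgf ρ (-u) * ENNReal.ofReal (Real.exp (u * x)) := by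
  have h := measure_Ici_le_lmgf ρ.neg hu (-x)
  rwa [lmgf_neg, neg_mul_neg, Measure.neg_apply, Set.neg_Ici, neg_neg] at h

/-- The part of the exponential moment of order `θ` carried by `[x₁, x₂]` is what remains after
exponential Chebyshev bounds on either side. -/
lemma lmgf_le_measure_Ici_add (ρ : Measure ℝ) {θ h x₁ x₂ : ℝ} (hθ : 0 ≤ θ) (hh : 0 ≤ h) :
    lmgf ρ θ ≤ ENNReal.ofReal (Real.exp (θ * x₂)) * ρ (Set.Ici x₁) +
      (ENNReal.ofReal (Real.exp (-h * x₂)) * lmgf ρ (θ + h) +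
        ENNReal.ofReal (Real.exp (h * x₁)) * lmgf ρ (θ - h)) := by
  simp only [lmgf]
  rw [← lintegral_const_mul _ (by fun_prop), ← lintegral_const_mul _ (by fun_prop),
    ← lintegral_indicator_const measurableSet_Ici, ← lintegral_add_left (by fun_prop),
    ← lintegral_add_left (by fun_prop (disch := exact measurableSet_Ici))]
  refine lintegral_mono fun y => ?_
  simp only [← ENNReal.ofReal_mul (Real.exp_pos _).le, ← Real.exp_add]
  rcases lt_or_ge y x₁ with hy₁ | hy₁
  · refine le_add_left (le_add_left ?_)
    gcongr
    nlinarith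
  rcases le_or_gt y x₂ with hy₂ | hy₂
  · refine le_add_right ?_
    rw [Set.indicator_of_mem (Set.mem_Ici.2 hy₁)]
    gcongr
  · refine le_add_left (le_add_right ?_)
    gcongr
    nlinarith

lemma lmgf_eq_top_of_decayRateLE {r : ℝ} (hρ : DecayRateLE (fun x => ρ (Set.Ici x)) r)
    (hu : 0 ≤ u) (hru : r < u) : lmgf ρ u = ∞ := by
  obtain ⟨q, hrq, hqu⟩ := exists_between hru
  by_contra hfin
  have hlim : Tendsto (fun x : ℝ => ENNReal.ofReal (Real.exp ((u - q) * x))) atTop (𝓝 ∞) :=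
    ENNReal.tendsto_ofReal_nhds_top.2 <|
      Real.tendsto_exp_atTop.comp (tendsto_id.const_mul_atTop (sub_pos.2 hqu))
  have hlarge := hlim.eventually_const_lt (lt_top_iff_ne_top.2 hfin)
  obtain ⟨x, hx, hlt⟩ := ((hρ q hrq).and hlarge).exists
  refine hlt.not_ge ?_
  calc ENNReal.ofReal (Real.exp ((u - q) * x))
      = ENNReal.ofReal (Real.exp (-q * x)) * ENNReal.ofReal (Real.exp (u * x)) := by
        rw [← ENNReal.ofReal_mul (Real.exp_pos _).le, ← Real.exp_add]
        ring_nf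
    _ ≤ lmgf ρ u * ENNReal.ofReal (Real.exp (-u * x)) * ENNReal.ofReal (Real.exp (u * x)) := by
        gcongr
        exact hx.trans (measure_Ici_le_lmgf ρ hu x)
    _ = lmgf ρ u := by
        rw [mul_assoc, ← ENNReal.ofReal_mul (Real.exp_pos _).le, ← Real.exp_add]
        simp

lemma isLUB_lmgf_ne_top {r : ℝ} (hr : 0 < r) (hfin : ∀ u ∈ Set.Ioo 0 r, lmgf ρ u ≠ ∞)
    (hρ : DecayRateLE (fun x => ρ (Set.Ici x)) r) : IsLUB {u | lmgf ρ u ≠ ∞} r := by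
  refine ⟨fun u hu => le_of_not_gt fun hru => ?_, fun c hc => ?_⟩
  · exact hu (lmgf_eq_top_of_decayRateLE hρ (hr.trans hru).le hru)
  · exact (isLUB_Ioo hr).2 fun u hur => hc (hfin u hur)

lemma isGLB_lmgf_ne_top {r : ℝ} (hr : 0 < r) (hfin : ∀ u ∈ Set.Ioo 0 r, lmgf ρ.neg u ≠ ∞)
    (hρ : DecayRateLE (fun x => ρ.neg (Set.Ici x)) r) : IsGLB {u | lmgf ρ u ≠ ∞} (-r) := by
  have h := isLUB_lmgf_ne_top hr hfin hρ
  simp only [lmgf_neg] at h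
  exact isLUB_neg.1 h

lemma isEquivalent_log_measure_Ioi {r : ℝ} (hr : 0 < r)
    (hfin : ∀ u ∈ Set.Ioo 0 r, lmgf ρ u ≠ ∞) (hρ : DecayRateLE (fun x => ρ (Set.Ici x)) r) :
    (fun x => Real.log (ρ.real (Set.Ioi x))) ~[atTop] fun x => -r * x := by
  have hIoi : DecayRateLE (fun x => ρ (Set.Ioi x)) r :=
    (hρ.comp_add_const 1).mono <| Eventually.of_forall fun x =>
      measure_mono fun _ hy => (lt_add_one x).trans_le hy
  exact hIoi.isEquivalent_log hr fun u hu => ⟨_, hfin u hu, fun x =>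
    (measure_mono Set.Ioi_subset_Ici_self).trans (measure_Ici_le_lmgf ρ hu.1.le x)⟩

lemma isEquivalent_log_measure_Ici {r : ℝ} (hr : 0 < r)
    (hfin : ∀ u ∈ Set.Ioo 0 r, lmgf ρ u ≠ ∞) (hρ : DecayRateLE (fun x => ρ (Set.Ici x)) r) :
    (fun x => Real.log (ρ.real (Set.Ici x))) ~[atTop] fun x => -r * x :=
  hρ.isEquivalent_log hr fun u hu => ⟨_, hfin u hu, measure_Ici_le_lmgf ρ hu.1.le⟩

section RandomVariable

variable {Ω : Type*} [MeasurableSpace Ω] {P : Measure Ω} {Y : Ω → ℝ}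

lemma isEquivalent_log_measure_lt (hY : AEMeasurable Y P) {r : ℝ} (hr : 0 < r)
    (hfin : ∀ u ∈ Set.Ioo 0 r, lmgf (P.map Y) u ≠ ∞)
    (hρ : DecayRateLE (fun x => P.map Y (Set.Ici x)) r) :
    (fun x => Real.log (P.real {ω | x < Y ω})) ~[atTop] fun x => -r * x := by
  have h := isEquivalent_log_measure_Ioi hr hfin hρ
  simp only [map_measureReal_apply_of_aemeasurable hY measurableSet_Ioi] at h
  exact h

lemma isEquivalent_log_measure_le_neg (hY : AEMeasurable Y P) {r : ℝ} (hr : 0 < r)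
    (hfin : ∀ u ∈ Set.Ioo 0 r, lmgf (P.map Y).neg u ≠ ∞)
    (hρ : DecayRateLE (fun x => (P.map Y).neg (Set.Ici x)) r) :
    (fun x => Real.log (P.real {ω | Y ω ≤ -x})) ~[atTop] fun x => -r * x := by
  have h := isEquivalent_log_measure_Ici hr hfin hρ
  simp only [measureReal_def, Measure.neg_apply, Set.neg_Ici,
    Measure.map_apply_of_aemeasurable hY measurableSet_Iic] at h
  exact h

end RandomVariable

end ExtendedMGF

noncomputable section CompoundPoisson

open scoped ENNReal Nat

/-- Iterated convolution powers of a measure on the real line. -/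
def convPow (ν : Measure ℝ) : ℕ → Measure ℝ
  | 0 => Measure.dirac 0
  | k + 1 => convPow ν k ∗ ν

/-- The compound Poisson law with jump measure `ν`, as a Poisson mixture of convolution powers. -/
def cpois (ν : Measure ℝ) : Measure ℝ :=
  Measure.sum fun k : ℕ => ENNReal.ofReal (Real.exp (-ν.real Set.univ) / k !) • convPow ν k

lemma convPow_one (ν : Measure ℝ) [SFinite ν] : convPow ν 1 = ν := by
  simp [convPow]

lemma smul_convPow_le_cpois (ν : Measure ℝ) (k : ℕ) :
    ENNReal.ofReal (Real.exp (-ν.real Set.univ) / k !) • convPow ν k ≤ cpois ν :=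
  Measure.le_sum _ k

lemma exp_neg_mul_measure_le_cpois (ν : Measure ℝ) [SFinite ν] (A : Set ℝ) :
    ENNReal.ofReal (Real.exp (-ν.real Set.univ)) * ν A ≤ cpois ν A := by
  simpa [convPow_one] using smul_convPow_le_cpois ν 1 A

lemma exp_neg_le_lmgf_cpois (ν : Measure ℝ) (u : ℝ) :
    ENNReal.ofReal (Real.exp (-ν.real Set.univ)) ≤ lmgf (cpois ν) u := by
  refine le_trans ?_ (lintegral_mono' (smul_convPow_le_cpois ν 0) le_rfl)
  simp [convPow]

variable (ν : Measure ℝ) [IsFiniteMeasure ν]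

instance isFiniteMeasure_convPow (k : ℕ) : IsFiniteMeasure (convPow ν k) := by
  induction k with
  | zero => unfold convPow; infer_instance
  | succ k ih => unfold convPow; infer_instance

lemma lmgf_convPow (u : ℝ) (k : ℕ) : lmgf (convPow ν k) u = lmgf ν u ^ k := by
  induction k with
  | zero => simp [convPow, lmgf]
  | succ k ih => rw [convPow, lmgf_conv, ih, pow_succ]

lemma lmgf_cpois {u : ℝ} (hu : Integrable (fun y => Real.exp (u * y)) ν) :
    lmgf (cpois ν) u = ENNReal.ofReal (Real.exp (∫ y, (Real.exp (u * y) - 1) ∂ν)) := by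
  have hI : 0 ≤ ∫ y, Real.exp (u * y) ∂ν := integral_nonneg fun y => (Real.exp_pos _).le
  have hs := (NormedSpace.expSeries_div_hasSum_exp (∫ y, Real.exp (u * y) ∂ν)).mul_left
    (Real.exp (-ν.real Set.univ))
  rw [← Real.exp_eq_exp_ℝ, ← Real.exp_add] at hs
  rw [integral_sub hu (integrable_const _), integral_const, smul_eq_mul, mul_one, sub_eq_neg_add,
    ← hs.tsum_eq, ENNReal.ofReal_tsum_of_nonneg (fun k => by positivity) hs.summable, lmgf, cpois,
    lintegral_sum_measure]
  refine tsum_congr fun k => ?_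
  rw [lintegral_smul_measure, ← lmgf, lmgf_convPow, ← ofReal_integral_exp_eq_lmgf hu, smul_eq_mul,
    ← ENNReal.ofReal_pow hI, ← ENNReal.ofReal_mul (by positivity)]
  ring_nf

instance isProbabilityMeasure_cpois : IsProbabilityMeasure (cpois ν) := by
  refine ⟨?_⟩
  rw [← lmgf_zero_right, lmgf_cpois ν (by simp)]
  simp

lemma charFun_convPow (t : ℝ) (k : ℕ) : charFun (convPow ν k) t = charFun ν t ^ k := by
  induction k with
  | zero => simp [convPow]
  | succ k ih => rw [convPow, charFun_conv, ih, pow_succ]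

lemma integrable_cexp_mul_I (t : ℝ) :
    Integrable (fun y : ℝ => Complex.exp (t * y * Complex.I)) ν := by
  refine (integrable_const (1 : ℝ)).mono' (by fun_prop) (ae_of_all _ fun y => ?_)
  exact_mod_cast (Complex.norm_exp_ofReal_mul_I (t * y)).le

lemma charFun_cpois (t : ℝ) :
    charFun (cpois ν) t = Complex.exp (charFun ν t - ν.real Set.univ) := by
  have hsum := hasSum_integral_measure (f := fun y : ℝ => Complex.exp (t * y * Complex.I))
    (μ := fun k : ℕ => ENNReal.ofReal (Real.exp (-ν.real Set.univ) / k !) • convPow ν k)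
    (integrable_cexp_mul_I (cpois ν) t)
  have hexp := (NormedSpace.expSeries_div_hasSum_exp (charFun ν t)).mul_left
    (Complex.exp (-ν.real Set.univ))
  rw [← Complex.exp_eq_exp_ℂ, ← Complex.exp_add, neg_add_eq_sub] at hexp
  rw [charFun_apply_real]
  refine hsum.unique (hexp.congr_fun fun k => ?_)
  rw [integral_smul_measure, ← charFun_apply_real, charFun_convPow,
    ENNReal.toReal_ofReal (by positivity), Complex.real_smul]
  push_cast
  ring

lemma cpois_add (ν' : Measure ℝ) [IsFiniteMeasure ν'] : cpois (ν + ν') = cpois ν ∗ cpois ν' := by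
  refine Measure.ext_of_charFun (funext fun t => ?_)
  rw [charFun_conv, charFun_cpois, charFun_cpois, charFun_cpois, ← Complex.exp_add]
  rw [measureReal_add_apply, charFun_apply_real, integral_add_measure
    (integrable_cexp_mul_I ν t) (integrable_cexp_mul_I ν' t), ← charFun_apply_real,
    ← charFun_apply_real]
  push_cast
  ring_nf

end CompoundPoisson

noncomputable section LevyExponent

open scoped ENNReal Topology

lemma exp_sub_one_sub_id_nonneg (w : ℝ) : 0 ≤ Real.exp w - 1 - w := by
  linarith [Real.add_one_le_exp w]

lemma exp_sub_one_le_mul_exp (w : ℝ) : Real.exp w - 1 ≤ w * Real.exp w := by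
  have h := Real.add_one_le_exp (-w)
  have hinv : Real.exp w * Real.exp (-w) = 1 := by rw [← Real.exp_add]; simp
  nlinarith [Real.exp_pos w]

lemma abs_exp_sub_one_le (w : ℝ) : |Real.exp w - 1| ≤ |w| * (1 + Real.exp w) := by
  have hexp := Real.exp_pos w
  rcases le_total 0 w with hw | hw
  · rw [abs_of_nonneg hw, abs_of_nonneg (sub_nonneg.2 (Real.one_le_exp hw))]
    nlinarith [exp_sub_one_le_mul_exp w]
  · rw [abs_of_nonpos hw, abs_of_nonpos (sub_nonpos.2 (Real.exp_le_one_iff.2 hw))]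
    nlinarith [Real.add_one_le_exp w]

lemma abs_mul_exp_sub_one_le (u y : ℝ) :
    |y * (Real.exp (u * y) - 1)| ≤ |u| * (y ^ 2 * (1 + Real.exp (u * y))) := by
  calc |y * (Real.exp (u * y) - 1)| ≤ |y| * (|u * y| * (1 + Real.exp (u * y))) := by
        rw [abs_mul]
        gcongr
        exact abs_exp_sub_one_le (u * y)
    _ = |u| * (y ^ 2 * (1 + Real.exp (u * y))) := by rw [abs_mul, ← sq_abs y]; ring

lemma exp_sub_one_sub_id_le (w : ℝ) : Real.exp w - 1 - w ≤ w ^ 2 * (1 + Real.exp w) := by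
  calc Real.exp w - 1 - w ≤ w * (Real.exp w - 1) := by linarith [exp_sub_one_le_mul_exp w]
    _ ≤ |w| * |Real.exp w - 1| := by rw [← abs_mul]; exact le_abs_self _
    _ ≤ |w| * (|w| * (1 + Real.exp w)) := by gcongr; exact abs_exp_sub_one_le w
    _ = w ^ 2 * (1 + Real.exp w) := by rw [← mul_assoc, abs_mul_abs_self]; ring

lemma norm_cexp_I_mul_sub_one_sub_le (w : ℝ) :
    ‖Complex.exp (Complex.I * w) - 1 - Complex.I * w‖ ≤ 3 * w ^ 2 := by
  have hnorm : ‖Complex.I * (w : ℂ)‖ = |w| := by simp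
  rcases le_total |w| 1 with hw | hw
  · have h := Complex.norm_exp_sub_one_sub_id_le (hnorm.trans_le hw)
    rw [hnorm, sq_abs] at h
    nlinarith [sq_nonneg w]
  · have h₁ : ‖Complex.exp (Complex.I * w) - 1‖ ≤ |w| := Real.norm_exp_I_mul_ofReal_sub_one_le
    have h₂ := norm_sub_le (Complex.exp (Complex.I * w) - 1) (Complex.I * (w : ℂ))
    rw [hnorm] at h₂
    nlinarith [sq_abs w]

lemma exp_mul_le_add {u₁ u₂ s : ℝ} (hs : s ∈ Set.Icc u₁ u₂) (y : ℝ) :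
    Real.exp (s * y) ≤ Real.exp (u₁ * y) + Real.exp (u₂ * y) := by
  rcases le_total 0 y with hy | hy
  · refine le_add_of_nonneg_of_le (Real.exp_pos _).le ?_
    exact Real.exp_le_exp.2 (mul_le_mul_of_nonneg_right hs.2 hy)
  · refine le_add_of_le_of_nonneg ?_ (Real.exp_pos _).le
    exact Real.exp_le_exp.2 (mul_le_mul_of_nonpos_right hs.1 hy)

/-- The orders `u` for which `∫ y² e^{uy} N(dy)` is finite. For a Lévy measure, the weight `y²`
takes care of the mass near zero, so these are essentially its finite exponential moments. -/
def levyExpMomentSet (N : Measure ℝ) : Set ℝ :=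
  {u | Integrable (fun y => y ^ 2 * Real.exp (u * y)) N}

/-- The Laplace exponent of the centred infinitely divisible law with Lévy measure `N`. -/
def levyExponent (N : Measure ℝ) (u : ℝ) : ℝ := ∫ y, (Real.exp (u * y) - 1 - u * y) ∂N

/-- The characteristic exponent of the centred infinitely divisible law with Lévy measure `N`. -/
def levyCharExponent (N : Measure ℝ) (t : ℝ) : ℂ :=
  ∫ y : ℝ, (Complex.exp (Complex.I * t * y) - 1 - Complex.I * t * y) ∂N

variable {N : Measure ℝ} {u : ℝ}

lemma zero_mem_levyExpMomentSet_iff :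
    0 ∈ levyExpMomentSet N ↔ Integrable (fun y => y ^ 2) N := by
  simp [levyExpMomentSet]

lemma mem_levyExpMomentSet_map_const_mul {s : ℝ} (hu : s * u ∈ levyExpMomentSet N) :
    u ∈ levyExpMomentSet (N.map (s * ·)) := by
  refine (integrable_map_measure (by fun_prop) (by fun_prop)).2 ?_
  refine (Integrable.const_mul hu (s ^ 2)).congr (ae_of_all _ fun y => ?_)
  simp only [Function.comp_apply]
  ring_nf

lemma integrable_exp_sub_one_sub (h0 : 0 ∈ levyExpMomentSet N) (hu : u ∈ levyExpMomentSet N) :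
    Integrable (fun y => Real.exp (u * y) - 1 - u * y) N := by
  refine ((zero_mem_levyExpMomentSet_iff.1 h0).add hu |>.const_mul (u ^ 2)).mono' (by fun_prop)
    (ae_of_all _ fun y => ?_)
  rw [Real.norm_of_nonneg (exp_sub_one_sub_id_nonneg _)]
  refine (exp_sub_one_sub_id_le _).trans_eq ?_
  simp only [Pi.add_apply]
  ring

lemma integrable_cexp_sub_one_sub (h0 : 0 ∈ levyExpMomentSet N) (t : ℝ) :
    Integrable (fun y : ℝ => Complex.exp (Complex.I * t * y) - 1 - Complex.I * t * y) N := by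
  refine ((zero_mem_levyExpMomentSet_iff.1 h0).const_mul (3 * t ^ 2)).mono' (by fun_prop)
    (ae_of_all _ fun y => ?_)
  have h := norm_cexp_I_mul_sub_one_sub_le (t * y)
  push_cast at h
  rw [← mul_assoc, mul_pow, ← mul_assoc] at h
  exact h

lemma levyExponent_zero_right (N : Measure ℝ) : levyExponent N 0 = 0 := by
  simp [levyExponent]

lemma levyExponent_nonneg (N : Measure ℝ) (u : ℝ) : 0 ≤ levyExponent N u :=
  integral_nonneg fun _ => exp_sub_one_sub_id_nonneg _

lemma levyExponent_mono_measure {N' : Measure ℝ} (h : N' ≤ N) (h0 : 0 ∈ levyExpMomentSet N)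
    (hu : u ∈ levyExpMomentSet N) : levyExponent N' u ≤ levyExponent N u :=
  integral_mono_measure h (ae_of_all _ fun _ => exp_sub_one_sub_id_nonneg _)
    (integrable_exp_sub_one_sub h0 hu)

lemma levyExponent_smul (c : ℝ≥0∞) (N : Measure ℝ) (u : ℝ) :
    levyExponent (c • N) u = c.toReal * levyExponent N u :=
  integral_smul_measure _ c

lemma levyCharExponent_map_const_mul (N : Measure ℝ) (s t : ℝ) :
    levyCharExponent (N.map (s * ·)) t = levyCharExponent N (s * t) := by
  rw [levyCharExponent, integral_map (by fun_prop) (by fun_prop)]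
  refine integral_congr_ae (ae_of_all _ fun y => ?_)
  push_cast
  ring_nf

lemma exists_mem_Ioo_of_mem_interior_levyExpMomentSet (hu : u ∈ interior (levyExpMomentSet N)) :
    ∃ u₁ ∈ levyExpMomentSet N, ∃ u₂ ∈ levyExpMomentSet N, u ∈ Set.Ioo u₁ u₂ := by
  obtain ⟨a, b, ⟨hau, hub⟩, hab⟩ := mem_nhds_iff_exists_Ioo_subset.1
    (mem_interior_iff_mem_nhds.1 hu)
  obtain ⟨u₁, hau₁, hu₁⟩ := exists_between hau
  obtain ⟨u₂, hu₂, hu₂b⟩ := exists_between hub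
  exact ⟨u₁, hab ⟨hau₁, hu₁.trans hub⟩, u₂, hab ⟨hau.trans hu₂, hu₂b⟩, hu₁, hu₂⟩

lemma integrable_mul_exp_sub_one (h0 : 0 ∈ levyExpMomentSet N) (hu : u ∈ levyExpMomentSet N) :
    Integrable (fun y => y * (Real.exp (u * y) - 1)) N := by
  refine ((zero_mem_levyExpMomentSet_iff.1 h0).add hu |>.const_mul |u|).mono' (by fun_prop)
    (ae_of_all _ fun y => ?_)
  exact (abs_mul_exp_sub_one_le u y).trans_eq (by simp only [Pi.add_apply]; ring)

lemma levyExponent_le_mul_deriv (h0 : 0 ∈ levyExpMomentSet N) (hu : u ∈ levyExpMomentSet N) :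
    levyExponent N u ≤ u * ∫ y, y * (Real.exp (u * y) - 1) ∂N := by
  rw [levyExponent, ← integral_const_mul]
  refine integral_mono (integrable_exp_sub_one_sub h0 hu)
    ((integrable_mul_exp_sub_one h0 hu).const_mul u) fun y => ?_
  linarith [exp_sub_one_le_mul_exp (u * y)]

lemma hasDerivAt_levyExponent (h0 : 0 ∈ levyExpMomentSet N)
    (hu : u ∈ interior (levyExpMomentSet N)) :
    HasDerivAt (levyExponent N) (∫ y, y * (Real.exp (u * y) - 1) ∂N) u := by
  obtain ⟨u₁, hm₁, u₂, hm₂, h₁, h₂⟩ := exists_mem_Ioo_of_mem_interior_levyExpMomentSet hu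
  have hbound := ((zero_mem_levyExpMomentSet_iff.1 h0).add (hm₁.add hm₂)).const_mul (max |u₁| |u₂|)
  refine (hasDerivAt_integral_of_dominated_loc_of_deriv_le (Ioo_mem_nhds h₁ h₂)
    (F := fun u y => Real.exp (u * y) - 1 - u * y) (F' := fun u y => y * (Real.exp (u * y) - 1))
    (Eventually.of_forall fun _ => by fun_prop)
    (integrable_exp_sub_one_sub h0 (interior_subset hu)) (by fun_prop)
    (ae_of_all _ fun y s hs => ?_) hbound (ae_of_all _ fun y s _ => ?_)).2
  · calc |y * (Real.exp (s * y) - 1)| ≤ |s| * (y ^ 2 * (1 + Real.exp (s * y))) :=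
          abs_mul_exp_sub_one_le s y
      _ ≤ max |u₁| |u₂| * (y ^ 2 * (1 + (Real.exp (u₁ * y) + Real.exp (u₂ * y)))) := by
          gcongr
          · exact abs_le_max_abs_abs hs.1.le hs.2.le
          · exact exp_mul_le_add (Set.Ioo_subset_Icc_self hs) y
      _ = _ := by simp only [Pi.add_apply]; ring
  · refine ((((hasDerivAt_id s).mul_const y).exp.sub_const 1).sub
      ((hasDerivAt_id s).mul_const y)).congr_deriv ?_
    simp only [id_eq, one_mul]
    ring

lemma hasDerivAt_deriv_levyExponent (h0 : 0 ∈ levyExpMomentSet N)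
    (hu : u ∈ interior (levyExpMomentSet N)) :
    HasDerivAt (fun u => ∫ y, y * (Real.exp (u * y) - 1) ∂N)
      (∫ y, y ^ 2 * Real.exp (u * y) ∂N) u := by
  obtain ⟨u₁, hm₁, u₂, hm₂, h₁, h₂⟩ := exists_mem_Ioo_of_mem_interior_levyExpMomentSet hu
  refine (hasDerivAt_integral_of_dominated_loc_of_deriv_le (Ioo_mem_nhds h₁ h₂)
    (F := fun u y => y * (Real.exp (u * y) - 1)) (F' := fun u y => y ^ 2 * Real.exp (u * y))
    (Eventually.of_forall fun _ => by fun_prop)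
    (integrable_mul_exp_sub_one h0 (interior_subset hu)) (by fun_prop)
    (ae_of_all _ fun y s hs => ?_) (hm₁.add hm₂) (ae_of_all _ fun y s _ => ?_)).2
  · rw [Real.norm_of_nonneg (by positivity), Pi.add_apply, ← mul_add]
    gcongr
    exact exp_mul_le_add (Set.Ioo_subset_Icc_self hs) y
  · refine ((((hasDerivAt_id s).mul_const y).exp.sub_const 1).const_mul y).congr_deriv ?_
    simp only [id_eq, one_mul]
    ring

lemma eqOn_levyExponent {s : Set ℝ} (hs : IsOpen s) (hs' : IsPreconnected s) (h0 : 0 ∈ s)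
    (hmem : s ⊆ levyExpMomentSet N) {f f' : ℝ → ℝ} (hf : ∀ u ∈ s, HasDerivAt f (f' u) u)
    (hf' : ∀ u ∈ s, HasDerivAt f' (∫ y, y ^ 2 * Real.exp (u * y) ∂N) u) (hf0 : f 0 = 0)
    (hf'0 : f' 0 = 0) : Set.EqOn (levyExponent N) f s := by
  have hint := interior_maximal hmem hs
  have hderiv {u : ℝ} (hu : u ∈ s) := hasDerivAt_levyExponent (hmem h0) (hint hu)
  have hderiv₂ {u : ℝ} (hu : u ∈ s) := hasDerivAt_deriv_levyExponent (hmem h0) (hint hu)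
  have hderiv_eq : Set.EqOn (fun u => ∫ y, y * (Real.exp (u * y) - 1) ∂N) f' s :=
    hs.eqOn_of_deriv_eq hs'
      (fun u hu => (hderiv₂ hu).differentiableAt.differentiableWithinAt)
      (fun u hu => (hf' u hu).differentiableAt.differentiableWithinAt)
      (fun u hu => by rw [(hderiv₂ hu).deriv, (hf' u hu).deriv]) h0 (by simp [hf'0])
  exact hs.eqOn_of_deriv_eq hs'
    (fun u hu => (hderiv hu).differentiableAt.differentiableWithinAt)
    (fun u hu => (hf u hu).differentiableAt.differentiableWithinAt)
    (fun u hu => by rw [(hderiv hu).deriv, (hf u hu).deriv]; exact hderiv_eq hu) h0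
    (by rw [levyExponent_zero_right, hf0])

end LevyExponent

noncomputable section CenteredCompoundPoisson

open scoped ENNReal Topology

/-- The compound Poisson law with jump measure `ν`, translated to have mean zero. -/
def centeredCpois (ν : Measure ℝ) : Measure ℝ := (cpois ν).map (· + -∫ y, y ∂ν)

variable {ν : Measure ℝ} [IsFiniteMeasure ν] {u : ℝ}

instance isProbabilityMeasure_centeredCpois : IsProbabilityMeasure (centeredCpois ν) :=
  Measure.isProbabilityMeasure_map (by fun_prop)

lemma lmgf_centeredCpois (hid : Integrable (fun y => y) ν)
    (hu : Integrable (fun y => Real.exp (u * y)) ν) :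
    lmgf (centeredCpois ν) u = ENNReal.ofReal (Real.exp (levyExponent ν u)) := by
  have hsub : Integrable (fun y => Real.exp (u * y) - 1) ν := hu.sub (integrable_const _)
  rw [centeredCpois, lmgf_map_add_const, lmgf_cpois ν hu, ← ENNReal.ofReal_mul (Real.exp_pos _).le,
    ← Real.exp_add, levyExponent, integral_sub hsub (hid.const_mul u),
    integral_const_mul]
  ring_nf

lemma charFun_centeredCpois (hid : Integrable (fun y => y) ν) (t : ℝ) :
    charFun (centeredCpois ν) t = Complex.exp (levyCharExponent ν t) := by
  have hexp : Integrable (fun y : ℝ => Complex.exp (Complex.I * t * y)) ν := by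
    simpa only [mul_comm, mul_left_comm] using integrable_cexp_mul_I ν t
  have hsub : Integrable (fun y : ℝ => Complex.exp (Complex.I * t * y) - 1) ν :=
    hexp.sub (integrable_const _)
  have hidc : Integrable (fun y : ℝ => Complex.I * t * (y : ℂ)) ν :=
    hid.ofReal.const_mul (Complex.I * t)
  have hchar : charFun ν t = ∫ y : ℝ, Complex.exp (Complex.I * t * y) ∂ν := by
    simp only [charFun_apply_real, mul_comm, mul_left_comm]
  rw [centeredCpois, charFun_map_add_const, charFun_cpois, levyCharExponent,
    integral_sub hsub hidc, integral_sub hexp (integrable_const _),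
    integral_const_mul, integral_complex_ofReal, integral_const, ← hchar, ← Complex.exp_add]
  simp
  ring_nf

lemma exp_levyExponent_sub_le_centeredCpois_Ici (hid : Integrable (fun y => y) ν) {θ h : ℝ}
    (hθ : 0 ≤ θ) (hh : 0 ≤ h) (hint : Integrable (fun y => Real.exp (θ * y)) ν)
    (hint_add : Integrable (fun y => Real.exp ((θ + h) * y)) ν)
    (hint_sub : Integrable (fun y => Real.exp ((θ - h) * y)) ν) (x₁ x₂ : ℝ) :
    ENNReal.ofReal (Real.exp (-θ * x₂) * (Real.exp (levyExponent ν θ) -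
        (Real.exp (levyExponent ν (θ + h) - h * x₂) +
          Real.exp (levyExponent ν (θ - h) + h * x₁)))) ≤ centeredCpois ν (Set.Ici x₁) := by
  have htilt := lmgf_le_measure_Ici_add (centeredCpois ν) (x₁ := x₁) (x₂ := x₂) hθ hh
  rw [lmgf_centeredCpois hid hint, lmgf_centeredCpois hid hint_add,
    lmgf_centeredCpois hid hint_sub] at htilt
  simp only [← ENNReal.ofReal_mul (Real.exp_pos _).le, ← Real.exp_add] at htilt
  rw [← ENNReal.ofReal_add (Real.exp_pos _).le (Real.exp_pos _).le, neg_mul, neg_add_eq_sub,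
    add_comm (h * x₁)] at htilt
  calc _ = ENNReal.ofReal (Real.exp (-θ * x₂)) * (ENNReal.ofReal (Real.exp (levyExponent ν θ)) -
        ENNReal.ofReal (Real.exp (levyExponent ν (θ + h) - h * x₂) +
          Real.exp (levyExponent ν (θ - h) + h * x₁))) := by
        rw [ENNReal.ofReal_mul (Real.exp_pos _).le, ENNReal.ofReal_sub _ (by positivity)]
    _ ≤ ENNReal.ofReal (Real.exp (-θ * x₂)) *
        (ENNReal.ofReal (Real.exp (θ * x₂)) * centeredCpois ν (Set.Ici x₁)) := by
        gcongr
        exact tsub_le_iff_right.2 htilt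
    _ = centeredCpois ν (Set.Ici x₁) := by
        rw [← mul_assoc, ← ENNReal.ofReal_mul (Real.exp_pos _).le, ← Real.exp_add]
        simp

lemma measure_Ioi_mul_le_conv_Ici (ρ τ : Measure ℝ) [SFinite τ] (x y : ℝ) :
    ρ (Set.Ioi x) * τ (Set.Ioi y) ≤ (ρ ∗ τ) (Set.Ici (x + y)) := by
  rw [Measure.conv, Measure.map_apply (by fun_prop) measurableSet_Ici, ← Measure.prod_prod]
  refine measure_mono ?_
  rintro ⟨a, b⟩ ⟨ha, hb⟩
  exact (add_lt_add (Set.mem_Ioi.1 ha) (Set.mem_Ioi.1 hb)).le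

/-- One big jump: a jump exceeding `z` brings the compound Poisson law above `z - K` unless the
independent remaining jumps bring it down by `K`. -/
lemma measure_Ioi_mul_le_centeredCpois_Ici (hid : Integrable (fun y => y) ν) {s : ℝ} (hs : 0 ≤ s)
    (hint : Integrable (fun y => Real.exp (-s * y)) ν) (z K : ℝ) :
    ENNReal.ofReal (Real.exp (-ν.real (Set.Ioi z))) * ν (Set.Ioi z) *
        (1 - ENNReal.ofReal (Real.exp (ν.real (Set.Ioi z) + levyExponent ν (-s) - s * K))) ≤
      centeredCpois ν (Set.Ici (z - K)) := by
  set big := ν.restrict (Set.Ioi z) with hbig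
  set R := (cpois (ν.restrict (Set.Ioi z)ᶜ)).map (· + -∫ y, y ∂ν) with hR
  have hbig_univ : big.real Set.univ = ν.real (Set.Ioi z) := measureReal_restrict_apply_univ _
  have : IsProbabilityMeasure R := Measure.isProbabilityMeasure_map (by fun_prop)
  have hsplit : centeredCpois ν = cpois big ∗ R := by
    refine Measure.ext_of_charFun (funext fun t => ?_)
    rw [centeredCpois, hR, charFun_map_add_const, charFun_conv, charFun_map_add_const, ← mul_assoc,
      ← charFun_conv, ← cpois_add, hbig, Measure.restrict_add_restrict_compl measurableSet_Ioi]
  have hjump : ENNReal.ofReal (Real.exp (-ν.real (Set.Ioi z))) * ν (Set.Ioi z) ≤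
      cpois big (Set.Ioi z) := by
    have h := exp_neg_mul_measure_le_cpois big (Set.Ioi z)
    rwa [hbig_univ, Measure.restrict_apply_self] at h
  have hrest : lmgf R (-s) ≤
      ENNReal.ofReal (Real.exp (ν.real (Set.Ioi z) + levyExponent ν (-s))) := by
    have h := mul_le_mul_left (exp_neg_le_lmgf_cpois big (-s)) (lmgf R (-s))
    rw [← lmgf_conv, ← hsplit, lmgf_centeredCpois hid hint, hbig_univ] at h
    calc lmgf R (-s) = ENNReal.ofReal (Real.exp (ν.real (Set.Ioi z))) *
          (ENNReal.ofReal (Real.exp (-ν.real (Set.Ioi z))) * lmgf R (-s)) := by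
          rw [← mul_assoc, ← ENNReal.ofReal_mul (Real.exp_pos _).le, ← Real.exp_add]
          simp
      _ ≤ _ := mul_le_mul_right h _
      _ = _ := by rw [← ENNReal.ofReal_mul (Real.exp_pos _).le, ← Real.exp_add]
  have hdown : R (Set.Iic (-K)) ≤
      ENNReal.ofReal (Real.exp (ν.real (Set.Ioi z) + levyExponent ν (-s) - s * K)) := by
    refine (measure_Iic_le_lmgf R hs (-K)).trans ((mul_le_mul_left hrest _).trans_eq ?_)
    rw [← ENNReal.ofReal_mul (Real.exp_pos _).le, ← Real.exp_add]
    ring_nf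
  have hstay : 1 - ENNReal.ofReal (Real.exp (ν.real (Set.Ioi z) + levyExponent ν (-s) - s * K)) ≤
      R (Set.Ioi (-K)) := by
    have hcompl : R (Set.Ioi (-K)) = 1 - R (Set.Iic (-K)) := by
      rw [← Set.compl_Iic, prob_compl_eq_one_sub measurableSet_Iic]
    exact (tsub_le_tsub_left hdown 1).trans_eq hcompl.symm
  rw [hsplit, sub_eq_add_neg]
  exact (mul_le_mul' hjump hstay).trans (measure_Ioi_mul_le_conv_Ici _ _ _ _)

end CenteredCompoundPoisson

noncomputable section CenteredLevyLaw

open scoped ENNReal Topology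

/-- The jumps of size larger than `1 / (n + 1)`, of which a Lévy measure has finite mass. -/
def largeJumps (n : ℕ) : Set ℝ := {y | 1 / ((n : ℝ) + 1) < |y|}

lemma measurableSet_largeJumps (n : ℕ) : MeasurableSet (largeJumps n) :=
  measurableSet_lt measurable_const (by fun_prop)

lemma monotone_largeJumps : Monotone largeJumps := fun m _ hmn y hy =>
  have hy : 1 / ((m : ℝ) + 1) < |y| := hy
  (Nat.one_div_le_one_div hmn).trans_lt hy

lemma iUnion_largeJumps : ⋃ n, largeJumps n = {0}ᶜ := by
  ext y
  simp only [Set.mem_iUnion, Set.mem_compl_singleton_iff]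
  constructor
  · rintro ⟨n, hn⟩
    exact abs_pos.1 (lt_trans (by positivity) hn)
  · exact fun hy => exists_nat_one_div_lt (abs_pos.2 hy)

lemma one_lt_mul_abs_of_mem_largeJumps {n : ℕ} {y : ℝ} (hy : y ∈ largeJumps n) :
    1 < ((n : ℝ) + 1) * |y| :=
  (div_lt_iff₀' (by positivity)).1 hy

lemma Ioi_subset_largeJumps {z : ℝ} (hz : 1 ≤ z) (n : ℕ) : Set.Ioi z ⊆ largeJumps n := by
  intro y hy
  have hn : 1 / ((n : ℝ) + 1) ≤ 1 := div_le_one_of_le₀ (by linarith [n.cast_nonneg (α := ℝ)])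
    (by positivity)
  exact (hn.trans hz).trans_lt (hy.trans_le (le_abs_self y))

variable {N : Measure ℝ} {u : ℝ}

lemma tendsto_setIntegral_largeJumps {E : Type*} [NormedAddCommGroup E] [NormedSpace ℝ E]
    {f : ℝ → E} (hf : Integrable f N) (h0 : f 0 = 0) :
    Tendsto (fun n => ∫ y in largeJumps n, f y ∂N) atTop (𝓝 (∫ y, f y ∂N)) := by
  have h := tendsto_setIntegral_of_monotone (μ := N) (f := f) measurableSet_largeJumps
    monotone_largeJumps hf.integrableOn
  rwa [iUnion_largeJumps, setIntegral_eq_integral_of_forall_compl_eq_zero] at h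
  rintro y hy
  rwa [Set.notMem_compl_iff.1 hy]

lemma integrableOn_largeJumps_exp (hu : u ∈ levyExpMomentSet N) (n : ℕ) :
    IntegrableOn (fun y => Real.exp (u * y)) (largeJumps n) N := by
  refine ((Integrable.const_mul hu (((n : ℝ) + 1) ^ 2)).integrableOn).mono' (by fun_prop)
    ((ae_restrict_mem (measurableSet_largeJumps n)).mono fun y hy => ?_)
  rw [Real.norm_of_nonneg (Real.exp_pos _).le, ← mul_assoc, ← sq_abs y, ← mul_pow]
  exact le_mul_of_one_le_left (Real.exp_pos _).le
    (one_le_pow₀ (one_lt_mul_abs_of_mem_largeJumps hy).le)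

lemma integrableOn_largeJumps_id (h0 : 0 ∈ levyExpMomentSet N) (n : ℕ) :
    IntegrableOn (fun y => y) (largeJumps n) N := by
  refine (((zero_mem_levyExpMomentSet_iff.1 h0).const_mul ((n : ℝ) + 1)).integrableOn).mono'
    (by fun_prop) ((ae_restrict_mem (measurableSet_largeJumps n)).mono fun y hy => ?_)
  rw [Real.norm_eq_abs, ← sq_abs y, sq, ← mul_assoc]
  exact le_mul_of_one_le_left (abs_nonneg y) (one_lt_mul_abs_of_mem_largeJumps hy).le

lemma isFiniteMeasure_restrict_largeJumps (h0 : 0 ∈ levyExpMomentSet N) (n : ℕ) :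
    IsFiniteMeasure (N.restrict (largeJumps n)) := by
  have h := integrableOn_largeJumps_exp h0 n
  simp only [zero_mul, Real.exp_zero, IntegrableOn] at h
  exact (integrable_const_iff_isFiniteMeasure one_ne_zero).1 h

/-- The centred compound Poisson law obtained by discarding the jumps of size at most
`1 / (n + 1)`. -/
def levyApprox (N : Measure ℝ) (n : ℕ) : Measure ℝ := centeredCpois (N.restrict (largeJumps n))

lemma lmgf_levyApprox (h0 : 0 ∈ levyExpMomentSet N) (hu : u ∈ levyExpMomentSet N) (n : ℕ) :
    lmgf (levyApprox N n) u =
      ENNReal.ofReal (Real.exp (levyExponent (N.restrict (largeJumps n)) u)) :=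
  have := isFiniteMeasure_restrict_largeJumps h0 n
  lmgf_centeredCpois (integrableOn_largeJumps_id h0 n) (integrableOn_largeJumps_exp hu n)

lemma charFun_levyApprox (h0 : 0 ∈ levyExpMomentSet N) (n : ℕ) (t : ℝ) :
    charFun (levyApprox N n) t =
      Complex.exp (levyCharExponent (N.restrict (largeJumps n)) t) :=
  have := isFiniteMeasure_restrict_largeJumps h0 n
  charFun_centeredCpois (integrableOn_largeJumps_id h0 n) t

lemma isProbabilityMeasure_levyApprox (h0 : 0 ∈ levyExpMomentSet N) (n : ℕ) :
    IsProbabilityMeasure (levyApprox N n) :=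
  have := isFiniteMeasure_restrict_largeJumps h0 n
  isProbabilityMeasure_centeredCpois

lemma tendsto_levyExponent_restrict_largeJumps (h0 : 0 ∈ levyExpMomentSet N)
    (hu : u ∈ levyExpMomentSet N) :
    Tendsto (fun n => levyExponent (N.restrict (largeJumps n)) u) atTop
      (𝓝 (levyExponent N u)) :=
  tendsto_setIntegral_largeJumps (integrable_exp_sub_one_sub h0 hu) (by simp)

lemma levyExponent_restrict_largeJumps_le (h0 : 0 ∈ levyExpMomentSet N)
    (hu : u ∈ levyExpMomentSet N) (n : ℕ) :
    levyExponent (N.restrict (largeJumps n)) u ≤ levyExponent N u :=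
  levyExponent_mono_measure Measure.restrict_le_self h0 hu

/-- `η` is the centred infinitely divisible law without Gaussian part and with Lévy measure `N`,
where `N` has a finite second moment. -/
structure IsCenteredLevyLaw (N η : Measure ℝ) : Prop where
  isProbabilityMeasure : IsProbabilityMeasure η
  zero_mem : 0 ∈ levyExpMomentSet N
  charFun_eq : ∀ t, charFun η t = Complex.exp (levyCharExponent N t)

namespace IsCenteredLevyLaw

variable {η : Measure ℝ} (hη : IsCenteredLevyLaw N η)
include hη

lemma map_const_mul (s : ℝ) : IsCenteredLevyLaw (N.map (s * ·)) (η.map (s * ·)) where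
  isProbabilityMeasure :=
    have := hη.isProbabilityMeasure
    Measure.isProbabilityMeasure_map (by fun_prop)
  zero_mem := mem_levyExpMomentSet_map_const_mul (by simpa using hη.zero_mem)
  charFun_eq t := by
    rw [charFun_map_mul, hη.charFun_eq, levyCharExponent_map_const_mul]

lemma tendsto_levyApprox :
    Tendsto (β := ProbabilityMeasure ℝ)
      (fun n => ⟨levyApprox N n, isProbabilityMeasure_levyApprox hη.zero_mem n⟩) atTop
      (𝓝 ⟨η, hη.isProbabilityMeasure⟩) := by
  refine ProbabilityMeasure.tendsto_of_tendsto_charFun fun t => ?_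
  simp only [ProbabilityMeasure.coe_mk, charFun_levyApprox hη.zero_mem, hη.charFun_eq]
  exact (Complex.continuous_exp.tendsto _).comp
    (tendsto_setIntegral_largeJumps (integrable_cexp_sub_one_sub hη.zero_mem t) (by simp))

lemma le_measure_of_le_levyApprox {A : Set ℝ} (hA : IsClosed A) {c : ℕ → ℝ≥0∞} {a : ℝ≥0∞}
    (hc : Tendsto c atTop (𝓝 a)) (hcA : ∀ n, c n ≤ levyApprox N n A) : a ≤ η A :=
  calc a = atTop.limsup c := hc.limsup_eq.symm
    _ ≤ atTop.limsup fun n => levyApprox N n A := limsup_le_limsup (Eventually.of_forall hcA)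
    _ ≤ η A := ProbabilityMeasure.limsup_measure_closed_le_of_tendsto hη.tendsto_levyApprox hA

lemma lmgf_le (hu : u ∈ levyExpMomentSet N) :
    lmgf η u ≤ ENNReal.ofReal (Real.exp (levyExponent N u)) := by
  have hfatou : lmgf η u ≤ atTop.liminf fun n => lmgf (levyApprox N n) u :=
    lintegral_le_liminf_lintegral_of_forall_isOpen_measure_le_liminf_measure (by fun_prop)
      (fun _ => (Real.exp_pos _).le)
      fun _ hG => ProbabilityMeasure.le_liminf_measure_open_of_tendsto hη.tendsto_levyApprox hG
  refine hfatou.trans (liminf_le_of_le (by isBoundedDefault) fun c hc => ?_)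
  obtain ⟨n, hn⟩ := hc.exists
  refine hn.trans ?_
  rw [lmgf_levyApprox hη.zero_mem hu]
  gcongr
  exact levyExponent_restrict_largeJumps_le hη.zero_mem hu n

lemma exp_levyExponent_sub_le_measure_Ici {θ h : ℝ} (hθ : 0 ≤ θ) (hh : 0 ≤ h)
    (hmem : θ ∈ levyExpMomentSet N) (hmem_add : θ + h ∈ levyExpMomentSet N)
    (hmem_sub : θ - h ∈ levyExpMomentSet N) (x₁ x₂ : ℝ) :
    ENNReal.ofReal (Real.exp (-θ * x₂) * (Real.exp (levyExponent N θ) -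
        (Real.exp (levyExponent N (θ + h) - h * x₂) +
          Real.exp (levyExponent N (θ - h) + h * x₁)))) ≤ η (Set.Ici x₁) := by
  have h0 := hη.zero_mem
  have hθlim := tendsto_levyExponent_restrict_largeJumps h0 hmem
  have haddlim := tendsto_levyExponent_restrict_largeJumps h0 hmem_add
  have hsublim := tendsto_levyExponent_restrict_largeJumps h0 hmem_sub
  refine hη.le_measure_of_le_levyApprox isClosed_Ici
    (ENNReal.tendsto_ofReal ((hθlim.rexp.sub ((haddlim.sub_const _).rexp.add
      (hsublim.add_const _).rexp)).const_mul _)) fun n => ?_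
  have := isFiniteMeasure_restrict_largeJumps h0 n
  exact exp_levyExponent_sub_le_centeredCpois_Ici (integrableOn_largeJumps_id h0 n) hθ hh
    (integrableOn_largeJumps_exp hmem n) (integrableOn_largeJumps_exp hmem_add n)
    (integrableOn_largeJumps_exp hmem_sub n) x₁ x₂

lemma measure_Ioi_mul_le_measure_Ici {s : ℝ} (hs : 0 ≤ s) (hmem : -s ∈ levyExpMomentSet N)
    {z : ℝ} (hz : 1 ≤ z) (K : ℝ) :
    ENNReal.ofReal (Real.exp (-N.real (Set.Ioi z))) * N (Set.Ioi z) *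
        (1 - ENNReal.ofReal (Real.exp (N.real (Set.Ioi z) + levyExponent N (-s) - s * K))) ≤
      η (Set.Ici (z - K)) := by
  have h0 := hη.zero_mem
  refine hη.le_measure_of_le_levyApprox isClosed_Ici tendsto_const_nhds fun n => ?_
  have := isFiniteMeasure_restrict_largeJumps h0 n
  have hIoi : N.restrict (largeJumps n) (Set.Ioi z) = N (Set.Ioi z) :=
    Measure.restrict_eq_self _ (Ioi_subset_largeJumps hz n)
  have hjump := measure_Ioi_mul_le_centeredCpois_Ici (integrableOn_largeJumps_id h0 n) hs
    (integrableOn_largeJumps_exp hmem n) z K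
  rw [measureReal_def, hIoi, ← measureReal_def] at hjump
  refine le_trans ?_ hjump
  gcongr
  exact levyExponent_restrict_largeJumps_le h0 hmem n

end IsCenteredLevyLaw

end CenteredLevyLaw

noncomputable section ConvolutionSemigroup

open scoped ENNReal Topology

lemma levyExpMomentSet_subset_smul {c : ℝ≥0∞} (hc : c ≠ ∞) (N : Measure ℝ) :
    levyExpMomentSet N ⊆ levyExpMomentSet (c • N) :=
  fun _ hu => Integrable.smul_measure hu hc

lemma levyExponent_ofReal_smul {v : ℝ} (hv : 0 ≤ v) (N : Measure ℝ) (u : ℝ) :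
    levyExponent (ENNReal.ofReal v • N) u = v * levyExponent N u := by
  rw [levyExponent_smul, ENNReal.toReal_ofReal hv]

lemma measure_Ioi_ne_top_of_zero_mem_levyExpMomentSet {N : Measure ℝ}
    (h0 : 0 ∈ levyExpMomentSet N) {z : ℝ} (hz : 1 ≤ z) : N (Set.Ioi z) ≠ ∞ := by
  have := isFiniteMeasure_restrict_largeJumps h0 0
  have h := measure_ne_top (N.restrict (largeJumps 0)) (Set.Ioi z)
  rwa [Measure.restrict_eq_self _ (Ioi_subset_largeJumps hz 0)] at h

lemma exists_lt_add_mul_and_lt_sub_mul_of_hasDerivAt {f : ℝ → ℝ} {m x e₁ e₂ : ℝ} {U : Set ℝ}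
    (hU : U ∈ 𝓝 x) (hf : HasDerivAt f m x) (h₁ : e₁ < m) (h₂ : m < e₂) :
    ∃ h > 0, x + h ∈ U ∧ x - h ∈ U ∧ f (x + h) < f x + h * e₂ ∧ f (x - h) < f x - h * e₁ := by
  have hneg : Tendsto (fun h : ℝ => -h) (𝓝[>] 0) (𝓝[<] 0) := by
    simpa using tendsto_neg_nhdsGT (a := (0 : ℝ))
  have hadd : ∀ᶠ h in 𝓝[>] (0 : ℝ), x + h ∈ U :=
    nhdsWithin_le_nhds ((continuous_const_add x).continuousAt.eventually (by simpa using hU))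
  have hsub : ∀ᶠ h in 𝓝[>] (0 : ℝ), x - h ∈ U :=
    nhdsWithin_le_nhds ((continuous_sub_left x).continuousAt.eventually (by simpa using hU))
  have hright := hf.tendsto_slope_zero_right.eventually_lt_const h₂
  have hleft := (hf.tendsto_slope_zero_left.comp hneg).eventually_const_lt h₁
  obtain ⟨h, hhadd, hhsub, hhr, hhl, hh⟩ :=
    (hadd.and (hsub.and (hright.and (hleft.and self_mem_nhdsWithin)))).exists
  have hh : 0 < h := hh
  refine ⟨h, hh, hhadd, hhsub, ?_, ?_⟩
  · rw [smul_eq_mul, inv_mul_lt_iff₀ hh] at hhr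
    linarith
  · simp only [Function.comp_apply, smul_eq_mul, inv_neg, neg_mul, ← sub_eq_add_neg] at hhl
    rw [lt_neg, inv_mul_lt_iff₀ hh] at hhl
    linarith

namespace IsCenteredLevyLaw

variable {N ζ : Measure ℝ} {v : ℝ}

lemma lmgf_le_exp_mul {u : ℝ} (hζ : IsCenteredLevyLaw (ENNReal.ofReal v • N) ζ) (hv : 0 ≤ v)
    (hu : u ∈ levyExpMomentSet N) :
    lmgf ζ u ≤ ENNReal.ofReal (Real.exp (v * levyExponent N u)) := by
  rw [← levyExponent_ofReal_smul hv]
  exact hζ.lmgf_le (levyExpMomentSet_subset_smul ENNReal.ofReal_ne_top N hu)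

lemma exists_mul_measure_Ioi_le (h0 : 0 ∈ levyExpMomentSet N) {s : ℝ} (hs : 0 < s)
    (hmem : -s ∈ levyExpMomentSet N) {p : ℝ} (hp : 0 < p) (q : ℝ) :
    ∃ c : ℝ≥0∞, c ≠ 0 ∧ ∃ K, ∀ v ∈ Set.Icc p q, ∀ ζ,
      IsCenteredLevyLaw (ENNReal.ofReal v • N) ζ →
        ∀ z ≥ 1, c * N (Set.Ioi z) ≤ ζ (Set.Ici (z - K)) := by
  set M := N.real (Set.Ioi 1)
  set K := (q * M + q * levyExponent N (-s) + 1) / s with hK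
  refine ⟨ENNReal.ofReal (Real.exp (-(q * M))) * ENNReal.ofReal p *
    (1 - ENNReal.ofReal (Real.exp (-1))), ?_, K, fun v ⟨hpv, hvq⟩ ζ hζ z hz => ?_⟩
  · have hlt : ENNReal.ofReal (Real.exp (-1)) < 1 := by simp
    have hexp := Real.exp_pos (-(q * M))
    exact mul_ne_zero (by simp [hexp, hp]) (tsub_pos_of_lt hlt).ne'
  have hv : 0 < v := hp.trans_le hpv
  have hmass : (ENNReal.ofReal v • N).real (Set.Ioi z) ≤ q * M := by
    rw [measureReal_ennreal_smul_apply, ENNReal.toReal_ofReal hv.le]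
    have hle : N.real (Set.Ioi z) ≤ M := measureReal_mono (Set.Ioi_subset_Ioi hz)
      (measure_Ioi_ne_top_of_zero_mem_levyExpMomentSet h0 le_rfl)
    exact mul_le_mul hvq hle measureReal_nonneg (hv.le.trans hvq)
  have hexponent : levyExponent (ENNReal.ofReal v • N) (-s) ≤ q * levyExponent N (-s) := by
    rw [levyExponent_ofReal_smul hv.le]
    exact mul_le_mul_of_nonneg_right hvq (levyExponent_nonneg N _)
  have hsK : s * K = q * M + q * levyExponent N (-s) + 1 := by rw [hK]; field_simp
  refine le_trans ?_ (hζ.measure_Ioi_mul_le_measure_Ici hs.le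
    (levyExpMomentSet_subset_smul ENNReal.ofReal_ne_top N hmem) hz K)
  rw [Measure.smul_apply, smul_eq_mul, mul_right_comm, mul_assoc (ENNReal.ofReal (Real.exp _))]
  gcongr
  linarith

/-- Cramér's lower bound, by exponential tilting: under the tilt by `θ` the law has mean `m * v`
and exponentially little mass outside `[e₁ * v, e₂ * v]`. -/
lemma eventually_le_measure_Ici {θ m e₁ e₂ : ℝ} (hθ : 0 ≤ θ)
    (hmem : θ ∈ interior (levyExpMomentSet N)) (hderiv : HasDerivAt (levyExponent N) m θ)
    (h₁ : e₁ < m) (h₂ : m < e₂) :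
    ∀ᶠ v in atTop, ∀ ζ, IsCenteredLevyLaw (ENNReal.ofReal v • N) ζ →
      ENNReal.ofReal (2⁻¹ * Real.exp (v * (levyExponent N θ - θ * e₂))) ≤
        ζ (Set.Ici (e₁ * v)) := by
  obtain ⟨h, hh, hadd, hsub, hψadd, hψsub⟩ := exists_lt_add_mul_and_lt_sub_mul_of_hasDerivAt
    (mem_interior_iff_mem_nhds.1 hmem) hderiv h₁ h₂
  set γ₂ := levyExponent N θ + h * e₂ - levyExponent N (θ + h) with hγ₂
  set γ₁ := levyExponent N θ - h * e₁ - levyExponent N (θ - h) with hγ₁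
  have hvanish (γ : ℝ) (hγ : 0 < γ) : ∀ᶠ v in atTop, Real.exp (-(γ * v)) < 1 / 4 :=
    (Real.tendsto_exp_neg_atTop_nhds_zero.comp (tendsto_id.const_mul_atTop hγ)).eventually_lt_const
      (by norm_num)
  filter_upwards [hvanish γ₁ (by linarith), hvanish γ₂ (by linarith), eventually_ge_atTop 0]
    with v hv₁ hv₂ hv ζ hζ
  have hsubset := levyExpMomentSet_subset_smul (ENNReal.ofReal_ne_top (r := v)) N
  refine le_trans (ENNReal.ofReal_le_ofReal ?_) (hζ.exp_levyExponent_sub_le_measure_Ici hθ hh.le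
    (hsubset (interior_subset hmem)) (hsubset hadd) (hsubset hsub) (e₁ * v) (e₂ * v))
  simp only [levyExponent_ofReal_smul hv]
  have hright : v * levyExponent N (θ + h) - h * (e₂ * v) =
      v * levyExponent N θ + -(γ₂ * v) := by rw [hγ₂]; ring
  have hleft : v * levyExponent N (θ - h) + h * (e₁ * v) =
      v * levyExponent N θ + -(γ₁ * v) := by rw [hγ₁]; ring
  calc 2⁻¹ * Real.exp (v * (levyExponent N θ - θ * e₂))
      = Real.exp (-θ * (e₂ * v)) * (Real.exp (v * levyExponent N θ) * 2⁻¹) := by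
        rw [mul_comm 2⁻¹, ← mul_assoc, ← Real.exp_add]
        ring_nf
    _ ≤ Real.exp (-θ * (e₂ * v)) * (Real.exp (v * levyExponent N θ) *
          (1 - (Real.exp (-(γ₂ * v)) + Real.exp (-(γ₁ * v))))) := by
        gcongr
        linarith
    _ = _ := by
        rw [hright, hleft, Real.exp_add, Real.exp_add]
        ring

end IsCenteredLevyLaw

end ConvolutionSemigroup

noncomputable section LevyMixture

open scoped ENNReal Topology

/-- `ρ` is the law of `μ + β V + L_V`, where `V` is positive with law `F` and `L` is an independent
centred Lévy process with Lévy measure `N`. The law of `L_v` is `η v`. -/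
structure IsLevyMixture (μ β : ℝ) (N F ρ : Measure ℝ) (η : ℝ → Measure ℝ) : Prop where
  ae_pos : ∀ᵐ v ∂F, 0 < v
  ae_law : ∀ᵐ v ∂F, IsCenteredLevyLaw (ENNReal.ofReal v • N) (η v)
  lintegral_eq : ∀ f : ℝ → ℝ≥0∞, Measurable f →
    ∫⁻ y, f y ∂ρ = ∫⁻ v, ∫⁻ y, f (μ + β * v + y) ∂(η v) ∂F

namespace IsLevyMixture

variable {μ β : ℝ} {N F ρ : Measure ℝ} {η : ℝ → Measure ℝ} (h : IsLevyMixture μ β N F ρ η)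
include h

lemma neg : IsLevyMixture (-μ) (-β) (N.map (-1 * ·)) F ρ.neg fun v => (η v).map (-1 * ·) where
  ae_pos := h.ae_pos
  ae_law := h.ae_law.mono fun v hv => by
    simpa only [Measure.map_smul] using hv.map_const_mul (-1)
  lintegral_eq f hf := by
    rw [Measure.neg, lintegral_map hf measurable_neg, h.lintegral_eq _ (by fun_prop)]
    refine lintegral_congr fun v => ?_
    rw [lintegral_map (by fun_prop) (by fun_prop)]
    refine lintegral_congr fun y => ?_
    ring_nf

lemma lmgf_le {u : ℝ} (hu : u ∈ levyExpMomentSet N) :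
    lmgf ρ u ≤ ENNReal.ofReal (Real.exp (u * μ)) * lmgf F (β * u + levyExponent N u) := by
  rw [lmgf, h.lintegral_eq _ (by fun_prop), lmgf, ← lintegral_const_mul _ (by fun_prop)]
  refine lintegral_mono_ae ?_
  filter_upwards [h.ae_pos, h.ae_law] with v hv hlaw
  calc ∫⁻ y, ENNReal.ofReal (Real.exp (u * (μ + β * v + y))) ∂(η v)
      = ENNReal.ofReal (Real.exp (u * μ + u * (β * v))) * lmgf (η v) u := by
        rw [lmgf, ← lintegral_const_mul _ (by fun_prop)]
        refine lintegral_congr fun y => ?_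
        rw [← ENNReal.ofReal_mul (Real.exp_pos _).le, ← Real.exp_add]
        ring_nf
    _ ≤ ENNReal.ofReal (Real.exp (u * μ + u * (β * v))) *
          ENNReal.ofReal (Real.exp (v * levyExponent N u)) := by
        gcongr
        exact hlaw.lmgf_le_exp_mul hv.le hu
    _ = _ := by
        simp only [← ENNReal.ofReal_mul (Real.exp_pos _).le, ← Real.exp_add]
        ring_nf

lemma mul_le_measure_Ici {S : Set ℝ} (hS : MeasurableSet S) {c : ℝ≥0∞} {x : ℝ}
    (hc : ∀ v ∈ S, 0 < v → ∀ ζ, IsCenteredLevyLaw (ENNReal.ofReal v • N) ζ →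
      c ≤ ζ (Set.Ici (x - μ - β * v))) :
    c * F S ≤ ρ (Set.Ici x) := by
  have hind (v y : ℝ) : (Set.Ici x).indicator 1 (μ + β * v + y) =
      (Set.Ici (x - μ - β * v)).indicator (1 : ℝ → ℝ≥0∞) y := by
    simp only [Set.indicator_apply, Set.mem_Ici, sub_sub, sub_le_iff_le_add', Pi.one_apply]
  rw [← lintegral_indicator_one measurableSet_Ici,
    h.lintegral_eq _ (measurable_one.indicator measurableSet_Ici), ← setLIntegral_const]
  refine (lintegral_mono_ae ?_).trans (setLIntegral_le_lintegral S _)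
  filter_upwards [ae_restrict_mem hS, ae_restrict_of_ae h.ae_pos, ae_restrict_of_ae h.ae_law]
    with v hvS hv hlaw
  simp only [hind]
  rw [lintegral_indicator_one measurableSet_Ici]
  exact hc v hvS hv _ hlaw

lemma decayRateLE_of_decayRateLE_levyMeasure (h0 : 0 ∈ levyExpMomentSet N) {s : ℝ} (hs : 0 < s)
    (hmem : -s ∈ levyExpMomentSet N) {p q : ℝ} (hp : 0 < p) (hF : F (Set.Icc p q) ≠ 0) {l : ℝ}
    (hN : DecayRateLE (fun x => N (Set.Ioi x)) l) :
    DecayRateLE (fun x => ρ (Set.Ici x)) l := by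
  obtain ⟨c, hc, K, hjump⟩ :=
    IsCenteredLevyLaw.exists_mul_measure_Ioi_le h0 hs hmem hp q
  refine ((hN.comp_add_const (-μ + |β| * q + K)).const_mul (mul_ne_zero hc hF)).mono ?_
  filter_upwards [eventually_ge_atTop (1 - (-μ + |β| * q + K))] with x hx
  rw [mul_right_comm]
  refine h.mul_le_measure_Ici measurableSet_Icc fun v hv hv0 ζ hζ => ?_
  refine (hjump v hv ζ hζ _ (by linarith)).trans (measure_mono (Set.Ici_subset_Ici.2 ?_))
  have hβ : -(β * v) ≤ |β| * q := by
    calc -(β * v) = -β * v := by ring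
      _ ≤ |β| * q := mul_le_mul (neg_le_abs β) hv.2 hv0.le (abs_nonneg β)
  linarith

/-- A large value is reached by letting `V` be near `w`: given `V = w`, the process tilted by `r`
has speed `m`, and the rate of its price and the rate `b` of the mixing law add up to at most
`r d₂`. -/
lemma decayRateLE_measure_Ici_affine {b r m d₁ d₂ : ℝ} (hr : 0 ≤ r)
    (hmem : r ∈ interior (levyExpMomentSet N)) (hderiv : HasDerivAt (levyExponent N) m r)
    (hroot : β * r + levyExponent N r = b) (hd₁ : 0 ≤ d₁) (hd₁m : d₁ < β + m) (hmd₂ : β + m < d₂)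
    (hF : DecayRateLE (fun w => F (Set.Icc w (w + 1))) b) :
    DecayRateLE (fun w => ρ (Set.Ici (d₁ * w + μ))) (r * d₂) := by
  set A := b - r * d₂ with hA
  have hrate : DecayRateLE (fun w => ENNReal.ofReal (2⁻¹ * Real.exp (-|A|)) *
      ENNReal.ofReal (Real.exp (- -A * w)) * F (Set.Icc w (w + 1))) (r * d₂) := by
    have hsum : -A + b = r * d₂ := by rw [hA]; ring
    simpa only [mul_assoc, hsum] using ((DecayRateLE.exp_neg_mul (p := -A)).mul hF).const_mul
      (ENNReal.ofReal_pos.2 (by positivity : 0 < 2⁻¹ * Real.exp (-|A|))).ne'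
  have hslope : levyExponent N r - r * (d₂ - β) = A := by rw [hA, ← hroot]; ring
  obtain ⟨v₀, hv₀⟩ := eventually_atTop.1 <| IsCenteredLevyLaw.eventually_le_measure_Ici hr
    hmem hderiv (e₁ := d₁ - β) (e₂ := d₂ - β) (by linarith) (by linarith)
  refine hrate.mono ?_
  filter_upwards [eventually_ge_atTop v₀] with w hw
  refine h.mul_le_measure_Ici measurableSet_Icc fun v hv _ ζ hζ => ?_
  calc ENNReal.ofReal (2⁻¹ * Real.exp (-|A|)) * ENNReal.ofReal (Real.exp (- -A * w))
      = ENNReal.ofReal (2⁻¹ * Real.exp (w * A - |A|)) := by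
        rw [← ENNReal.ofReal_mul (by positivity), mul_assoc, ← Real.exp_add]
        ring_nf
    _ ≤ ENNReal.ofReal (2⁻¹ * Real.exp (v * A)) := by
        gcongr
        nlinarith [hv.1, hv.2, neg_le_abs A, abs_nonneg A]
    _ ≤ ζ (Set.Ici ((d₁ - β) * v)) := hslope ▸ hv₀ v (hw.trans hv.1) ζ hζ
    _ ≤ ζ (Set.Ici (d₁ * w + μ - μ - β * v)) := by
        refine measure_mono (Set.Ici_subset_Ici.2 ?_)
        linarith [mul_le_mul_of_nonneg_left hv.1 hd₁]

lemma decayRateLE_of_root (h0 : 0 ∈ levyExpMomentSet N) {b r : ℝ} (hb : 0 < b) (hr : 0 < r)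
    (hmem : r ∈ interior (levyExpMomentSet N)) (hroot : β * r + levyExponent N r = b)
    (hF : DecayRateLE (fun w => F (Set.Icc w (w + 1))) b) :
    DecayRateLE (fun x => ρ (Set.Ici x)) r := by
  refine .of_forall_gt fun q hq => ?_
  set m := ∫ y, y * (Real.exp (r * y) - 1) ∂N
  have hderiv : HasDerivAt (levyExponent N) m r := hasDerivAt_levyExponent h0 hmem
  have hm : 0 < β + m := by
    have hconvex : levyExponent N r ≤ r * m := levyExponent_le_mul_deriv h0 (interior_subset hmem)
    exact pos_of_mul_pos_right (by linarith : 0 < r * (β + m)) hr.le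
  set κ := √(q / r)
  have hκ : 1 < κ := Real.lt_sqrt_of_sq_lt (by rwa [one_pow, one_lt_div hr])
  have hκsq : κ * κ = q / r := Real.mul_self_sqrt (div_nonneg (hr.trans hq).le hr.le)
  have hd₁ : 0 < (β + m) / κ := div_pos hm (by linarith)
  have hspeed := (h.decayRateLE_measure_Ici_affine hr.le hmem hderiv
    hroot hd₁.le (div_lt_self hm hκ) (lt_mul_of_one_lt_right hm hκ) hF).comp_affine
    (inv_pos.2 hd₁) (-(((β + m) / κ)⁻¹ * μ))
  have hq_eq : r * ((β + m) * κ) * ((β + m) / κ)⁻¹ = q := by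
    calc r * ((β + m) * κ) * ((β + m) / κ)⁻¹ = r * (κ * κ) := by field_simp
      _ = q := by rw [hκsq]; field_simp
  have hx (x : ℝ) : (β + m) / κ * (((β + m) / κ)⁻¹ * x + -(((β + m) / κ)⁻¹ * μ)) + μ = x := by
    rw [← mul_neg, ← mul_add, mul_inv_cancel_left₀ hd₁.ne']
    ring
  simpa only [hx, hq_eq] using hspeed

end IsLevyMixture

end LevyMixture

noncomputable section GammaLaw

open scoped ENNReal Topology

variable {a b : ℝ}

lemma exp_mul_gammaPDFReal (hb : 0 < b) {c : ℝ} (hc : c < b) (v : ℝ) :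
    Real.exp (c * v) * gammaPDFReal a b v = (b / (b - c)) ^ a * gammaPDFReal a (b - c) v := by
  unfold gammaPDFReal
  split_ifs
  · have hbc : 0 < b - c := sub_pos.2 hc
    have hexp : Real.exp (-((b - c) * v)) = Real.exp (c * v) * Real.exp (-(b * v)) := by
      rw [← Real.exp_add]
      ring_nf
    rw [hexp, Real.div_rpow hb.le hbc.le]
    field_simp
  · simp only [mul_zero]

lemma lmgf_gammaMeasure (ha : 0 < a) (hb : 0 < b) {c : ℝ} (hc : c < b) :
    lmgf (gammaMeasure a b) c = ENNReal.ofReal ((b / (b - c)) ^ a) := by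
  have hbc : 0 < b - c := sub_pos.2 hc
  have hmeas (r : ℝ) : Measurable (gammaPDF a r) := (measurable_gammaPDFReal a r).ennreal_ofReal
  calc lmgf (gammaMeasure a b) c
      = ∫⁻ v, ENNReal.ofReal ((b / (b - c)) ^ a) * gammaPDF a (b - c) v := by
        rw [lmgf, gammaMeasure, lintegral_withDensity_eq_lintegral_mul _ (hmeas b) (by fun_prop)]
        refine lintegral_congr fun v => ?_
        rw [Pi.mul_apply, mul_comm, gammaPDF, gammaPDF, ← ENNReal.ofReal_mul (Real.exp_pos _).le,
          ← ENNReal.ofReal_mul (by positivity), exp_mul_gammaPDFReal hb hc]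
    _ = _ := by
        rw [lintegral_const_mul _ (hmeas _), lintegral_gammaPDF_eq_one ha hbc, mul_one]

lemma integrable_gammaPDFReal (ha : 0 < a) (hb : 0 < b) : Integrable (gammaPDFReal a b) := by
  rw [← lintegral_ofReal_ne_top_iff_integrable (measurable_gammaPDFReal a b).aestronglyMeasurable
    (ae_of_all _ (gammaPDFReal_nonneg ha hb))]
  exact (lintegral_gammaPDF_eq_one ha hb).trans_ne ENNReal.one_ne_top

lemma integral_gammaPDFReal (ha : 0 < a) (hb : 0 < b) : ∫ v, gammaPDFReal a b v = 1 := by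
  rw [integral_eq_lintegral_of_nonneg_ae (ae_of_all _ (gammaPDFReal_nonneg ha hb))
    (measurable_gammaPDFReal a b).aestronglyMeasurable]
  exact congrArg ENNReal.toReal (lintegral_gammaPDF_eq_one ha hb)

lemma decayRateLE_gammaMeasure_Icc (ha : 0 < a) (hb : 0 < b) :
    DecayRateLE (fun w => gammaMeasure a b (Set.Icc w (w + 1))) b := by
  refine DecayRateLE.withDensity_Icc <| (DecayRateLE.const_mul_rpow_mul_exp
    (div_pos (Real.rpow_pos_of_pos hb a) (Real.Gamma_pos_of_pos ha)) (a - 1)).mono ?_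
  filter_upwards [eventually_ge_atTop 0] with v hv
  rw [gammaPDF_of_nonneg hv, neg_mul, mul_assoc]

end GammaLaw

noncomputable section TemperedStableLevyMeasure

open scoped ENNReal Topology

/-- The Lévy measure of the classical tempered stable law `CTS(α, lp, lm, Cp, Cm, m)`. -/
def ctsLevyMeasure (α lp lm Cp Cm : ℝ) : Measure ℝ :=
  volume.withDensity fun y => ENNReal.ofReal (ctsLevyDensity α lp lm Cp Cm y)

variable {α lp lm Cp Cm : ℝ}

lemma measurable_ctsLevyDensity (α lp lm Cp Cm : ℝ) :
    Measurable (ctsLevyDensity α lp lm Cp Cm) := by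
  unfold ctsLevyDensity
  exact Measurable.ite measurableSet_Ioi (by fun_prop) <|
    Measurable.ite measurableSet_Iio (by fun_prop) measurable_const

lemma ctsLevyDensity_nonneg (hCp : 0 ≤ Cp) (hCm : 0 ≤ Cm) (y : ℝ) :
    0 ≤ ctsLevyDensity α lp lm Cp Cm y := by
  unfold ctsLevyDensity
  split_ifs <;> positivity

lemma integral_ctsLevyMeasure {E : Type*} [NormedAddCommGroup E] [NormedSpace ℝ E]
    (hCp : 0 ≤ Cp) (hCm : 0 ≤ Cm) (f : ℝ → E) :
    ∫ y, f y ∂(ctsLevyMeasure α lp lm Cp Cm) = ∫ y, ctsLevyDensity α lp lm Cp Cm y • f y := by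
  rw [ctsLevyMeasure, integral_withDensity_eq_integral_toReal_smul
    (measurable_ctsLevyDensity _ _ _ _ _).ennreal_ofReal
    (ae_of_all _ fun _ => ENNReal.ofReal_lt_top)]
  simp only [ENNReal.toReal_ofReal (ctsLevyDensity_nonneg hCp hCm _)]

lemma integrable_ctsLevyMeasure_iff (hCp : 0 ≤ Cp) (hCm : 0 ≤ Cm) {f : ℝ → ℝ} :
    Integrable f (ctsLevyMeasure α lp lm Cp Cm) ↔
      Integrable fun y => ctsLevyDensity α lp lm Cp Cm y • f y := by
  rw [ctsLevyMeasure, integrable_withDensity_iff_integrable_smul'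
    (measurable_ctsLevyDensity _ _ _ _ _).ennreal_ofReal
    (ae_of_all _ fun _ => ENNReal.ofReal_lt_top)]
  simp only [ENNReal.toReal_ofReal (ctsLevyDensity_nonneg hCp hCm _)]

lemma smul_ctsLevyMeasure {c : ℝ} (hc : 0 ≤ c) :
    ENNReal.ofReal c • ctsLevyMeasure α lp lm Cp Cm =
      ctsLevyMeasure α lp lm (c * Cp) (c * Cm) := by
  rw [ctsLevyMeasure, ctsLevyMeasure, ← withDensity_smul _
    (measurable_ctsLevyDensity _ _ _ _ _).ennreal_ofReal]
  congr 1 with y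
  rw [Pi.smul_apply, smul_eq_mul, ← ENNReal.ofReal_mul hc]
  unfold ctsLevyDensity
  split_ifs <;> ring_nf

lemma map_const_mul_withDensity {s : ℝ} (hs : s ≠ 0) {f : ℝ → ℝ≥0∞} (hf : Measurable f) :
    (volume.withDensity f).map (s * ·) =
      volume.withDensity fun y => ENNReal.ofReal |s⁻¹| * f (s⁻¹ * y) := by
  ext A hA
  have hmul : Measurable fun x : ℝ => s * x := by fun_prop
  rw [Measure.map_apply hmul hA, withDensity_apply _ (hmul hA), withDensity_apply _ hA,
    lintegral_const_mul _ (by fun_prop), ← smul_eq_mul, ← lintegral_smul_measure,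
    ← Measure.restrict_smul, ← Real.map_volume_mul_left hs, setLIntegral_map hA (by fun_prop) hmul]
  simp only [inv_mul_cancel_left₀ hs]

lemma map_neg_ctsLevyMeasure (α lp lm Cp Cm : ℝ) :
    (ctsLevyMeasure α lp lm Cp Cm).map (-1 * ·) = ctsLevyMeasure α lm lp Cm Cp := by
  rw [ctsLevyMeasure, map_const_mul_withDensity (by norm_num)
    (measurable_ctsLevyDensity _ _ _ _ _).ennreal_ofReal, ctsLevyMeasure]
  congr 1 with y
  have hdensity : ctsLevyDensity α lp lm Cp Cm (-y) = ctsLevyDensity α lm lp Cm Cp y := by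
    unfold ctsLevyDensity
    rcases lt_trichotomy y 0 with hy | rfl | hy
    · rw [if_pos (neg_pos.2 hy), if_neg hy.not_gt, if_pos hy, abs_of_neg hy]
    · simp
    · rw [if_neg (neg_neg_of_pos hy).not_gt, if_pos (neg_neg_of_pos hy), if_pos hy, abs_neg,
        abs_of_pos hy]
  simp [hdensity]

lemma map_const_mul_ctsLevyMeasure {s : ℝ} (hs : 0 < s) :
    (ctsLevyMeasure α (lp * s) (lm * s) Cp Cm).map (s * ·) =
      ctsLevyMeasure α lp lm (s ^ α * Cp) (s ^ α * Cm) := by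
  rw [ctsLevyMeasure, map_const_mul_withDensity hs.ne'
    (measurable_ctsLevyDensity _ _ _ _ _).ennreal_ofReal, ctsLevyMeasure]
  congr 1 with y
  have hside (C l z : ℝ) (hz : 0 < z) :
      s⁻¹ * (C * Real.exp (-(l * s) * (s⁻¹ * z)) / (s⁻¹ * z) ^ (1 + α)) =
        s ^ α * C * Real.exp (-l * z) / z ^ (1 + α) := by
    have hexp : -(l * s) * (s⁻¹ * z) = -l * z := by field_simp
    rw [hexp, Real.mul_rpow (inv_pos.2 hs).le hz.le, Real.inv_rpow hs.le, Real.rpow_add hs,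
      Real.rpow_one]
    field_simp
  rw [abs_of_pos (inv_pos.2 hs), ← ENNReal.ofReal_mul (inv_pos.2 hs).le]
  unfold ctsLevyDensity
  rcases lt_trichotomy y 0 with hy | rfl | hy
  · have hsy : s⁻¹ * y < 0 := mul_neg_of_pos_of_neg (inv_pos.2 hs) hy
    rw [if_neg hsy.not_gt, if_pos hsy, if_neg hy.not_gt, if_pos hy, abs_mul,
      abs_of_pos (inv_pos.2 hs), hside _ _ _ (abs_pos.2 hy.ne)]
  · simp
  · rw [if_pos (mul_pos (inv_pos.2 hs) hy), if_pos hy, hside _ _ _ hy]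

lemma ctsLevyDensity_smul_sq_mul_exp_ae_eq (hα : α < 2) {u : ℝ} (hu : u ∈ Set.Ioo (-lm) lp) :
    (fun y => ctsLevyDensity α lp lm Cp Cm y • (y ^ 2 * Real.exp (u * y))) =ᵐ[volume] fun y =>
      Cp * Real.Gamma (2 - α) * (lp - u) ^ (α - 2) * gammaPDFReal (2 - α) (lp - u) y +
        Cm * Real.Gamma (2 - α) * (lm + u) ^ (α - 2) * gammaPDFReal (2 - α) (lm + u) (-y) := by
  have hside (C l w z : ℝ) (hlw : 0 < l - w) (hz : 0 < z) :
      C * Real.exp (-l * z) / z ^ (1 + α) * (z ^ 2 * Real.exp (w * z)) =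
        C * Real.Gamma (2 - α) * (l - w) ^ (α - 2) * gammaPDFReal (2 - α) (l - w) z := by
    have hΓ : 0 < Real.Gamma (2 - α) := Real.Gamma_pos_of_pos (by linarith)
    have hpow : z ^ (2 - α - 1) = z ^ 2 / z ^ (1 + α) := by
      rw [← Real.rpow_natCast z 2, ← Real.rpow_sub hz]
      push_cast
      ring_nf
    have hexp : Real.exp (-((l - w) * z)) = Real.exp (-l * z) * Real.exp (w * z) := by
      rw [← Real.exp_add]
      ring_nf
    have hcancel : (l - w) ^ (α - 2) * (l - w) ^ (2 - α) = 1 := by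
      rw [← Real.rpow_add hlw, sub_add_sub_cancel, sub_self, Real.rpow_zero]
    rw [gammaPDFReal, if_pos hz.le, hpow, hexp]
    field_simp
    linear_combination -C * hcancel
  have hne : ∀ᵐ y : ℝ, y ≠ 0 := by simp [ae_iff]
  filter_upwards [hne] with y hy
  rw [smul_eq_mul]
  unfold ctsLevyDensity
  rcases hy.lt_or_gt with hy | hy
  · have hzero : gammaPDFReal (2 - α) (lp - u) y = 0 := if_neg hy.not_ge
    have hm := hside Cm lm (-u) (-y) (by linarith [hu.1]) (neg_pos.2 hy)
    rw [sub_neg_eq_add, neg_mul_neg u y, neg_sq y] at hm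
    rw [if_neg hy.not_gt, if_pos hy, abs_of_neg hy, hm, hzero, mul_zero, zero_add]
  · have hzero : gammaPDFReal (2 - α) (lm + u) (-y) = 0 := if_neg (neg_neg_of_pos hy).not_ge
    rw [if_pos hy, hside Cp lp u y (by linarith [hu.2]) hy, hzero, mul_zero, add_zero]

lemma Ioo_subset_levyExpMomentSet_ctsLevyMeasure (hα : α < 2) (hCp : 0 ≤ Cp) (hCm : 0 ≤ Cm) :
    Set.Ioo (-lm) lp ⊆ levyExpMomentSet (ctsLevyMeasure α lp lm Cp Cm) := fun u hu => by
  refine (integrable_ctsLevyMeasure_iff hCp hCm).2 <|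
    Integrable.congr ?_ (ctsLevyDensity_smul_sq_mul_exp_ae_eq hα hu).symm
  exact ((integrable_gammaPDFReal (by linarith) (by linarith [hu.2])).const_mul _).add
    ((integrable_gammaPDFReal (by linarith) (by linarith [hu.1])).comp_neg.const_mul _)

lemma integral_sq_mul_exp_ctsLevyMeasure (hα : α < 2) (hCp : 0 ≤ Cp) (hCm : 0 ≤ Cm) {u : ℝ}
    (hu : u ∈ Set.Ioo (-lm) lp) :
    ∫ y, y ^ 2 * Real.exp (u * y) ∂(ctsLevyMeasure α lp lm Cp Cm) =
      Real.Gamma (2 - α) * (Cp * (lp - u) ^ (α - 2) + Cm * (lm + u) ^ (α - 2)) := by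
  have hα' : 0 < 2 - α := by linarith
  have hlp : 0 < lp - u := by linarith [hu.2]
  have hlm : 0 < lm + u := by linarith [hu.1]
  rw [integral_ctsLevyMeasure hCp hCm, integral_congr_ae
    (ctsLevyDensity_smul_sq_mul_exp_ae_eq hα hu), integral_add
    ((integrable_gammaPDFReal hα' hlp).const_mul _)
    ((integrable_gammaPDFReal hα' hlm).comp_neg.const_mul _), integral_const_mul,
    integral_const_mul, integral_neg_eq_self, integral_gammaPDFReal hα' hlp,
    integral_gammaPDFReal hα' hlm]
  ring

lemma decayRateLE_ctsLevyMeasure_Ioi (α lp lm Cm : ℝ) (hCp : 0 < Cp) :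
    DecayRateLE (fun x => ctsLevyMeasure α lp lm Cp Cm (Set.Ioi x)) lp := by
  refine (DecayRateLE.withDensity_Icc <|
    (DecayRateLE.const_mul_rpow_mul_exp hCp (-(1 + α))).mono ?_).measure_Ioi
  filter_upwards [eventually_gt_atTop 0] with y hy
  rw [ctsLevyDensity, if_pos hy, Real.rpow_neg hy.le]
  exact (congrArg ENNReal.ofReal (by ring)).le

lemma IsCTS.isCenteredLevyLaw {ρ : Measure ℝ} (h : IsCTS α lp lm Cp Cm 0 ρ) (hα : α < 2)
    (hlp : 0 < lp) (hlm : 0 < lm) (hCp : 0 ≤ Cp) (hCm : 0 ≤ Cm) :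
    IsCenteredLevyLaw (ctsLevyMeasure α lp lm Cp Cm) ρ where
  isProbabilityMeasure := h.isProbabilityMeasure
  zero_mem := Ioo_subset_levyExpMomentSet_ctsLevyMeasure hα hCp hCm ⟨neg_neg_of_pos hlm, hlp⟩
  charFun_eq t := by
    rw [h.charFun_eq, ctsCharExponent, levyCharExponent, integral_ctsLevyMeasure hCp hCm]
    simp only [Complex.ofReal_zero, mul_zero, zero_add, Complex.real_smul, mul_comm]

end TemperedStableLevyMeasure

noncomputable section TemperedStableExponent

open scoped ENNReal Topology

/-- The integral `∫ (e^{ux} - 1 - ux) e^{-lx} x^{-1-α} dx` over `x > 0`, divided by `Γ(2 - α)`: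
up to a constant, the Laplace exponent of the centred one-sided tempered stable law. -/
def temperedStableExponent (α l u : ℝ) : ℝ :=
  if α = 1 then (l - u) * Real.log ((l - u) / l) + u
  else ((l - u) ^ α - l ^ α) / (α * (α - 1)) + l ^ (α - 1) * u / (α - 1)

/-- The derivative of `temperedStableExponent α l` on `(-∞, l)`. -/
def temperedStableExponentDeriv (α l u : ℝ) : ℝ :=
  if α = 1 then -Real.log ((l - u) / l) else (l ^ (α - 1) - (l - u) ^ (α - 1)) / (α - 1)

variable {α l u : ℝ}

lemma temperedStableExponent_zero_right (hl : 0 < l) : temperedStableExponent α l 0 = 0 := by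
  unfold temperedStableExponent
  split_ifs <;> simp [hl.ne']

lemma temperedStableExponentDeriv_zero_right (hl : 0 < l) :
    temperedStableExponentDeriv α l 0 = 0 := by
  unfold temperedStableExponentDeriv
  split_ifs <;> simp [hl.ne']

lemma hasDerivAt_temperedStableExponent (hα : 0 < α) (hl : 0 < l) (hu : u < l) :
    HasDerivAt (temperedStableExponent α l) (temperedStableExponentDeriv α l u) u := by
  have hlu : 0 < l - u := sub_pos.2 hu
  have hsub : HasDerivAt (fun u => l - u) (-1) u := (hasDerivAt_id u).const_sub l
  unfold temperedStableExponent temperedStableExponentDeriv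
  split_ifs with h1
  · refine ((hsub.mul ((hsub.div_const l).log (div_pos hlu hl).ne')).add
      (hasDerivAt_id u)).congr_deriv ?_
    field_simp
    ring
  · have hα1 : α - 1 ≠ 0 := sub_ne_zero.2 h1
    refine ((((hsub.rpow_const (Or.inl hlu.ne')).sub_const _).div_const _).add
      (((hasDerivAt_id u).const_mul _).div_const _)).congr_deriv ?_
    field_simp
    ring

lemma hasDerivAt_temperedStableExponentDeriv (hl : 0 < l) (hu : u < l) :
    HasDerivAt (temperedStableExponentDeriv α l) ((l - u) ^ (α - 2)) u := by
  have hlu : 0 < l - u := sub_pos.2 hu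
  have hsub : HasDerivAt (fun u => l - u) (-1) u := (hasDerivAt_id u).const_sub l
  unfold temperedStableExponentDeriv
  split_ifs with h1
  · have hpow : (l - u) ^ (α - 2) = (l - u)⁻¹ := by
      rw [← Real.rpow_neg_one, h1]
      norm_num
    refine ((hsub.div_const l).log (div_pos hlu hl).ne').neg.congr_deriv ?_
    rw [hpow]
    field_simp
  · have hα1 : α - 1 ≠ 0 := sub_ne_zero.2 h1
    refine (((hsub.rpow_const (Or.inl hlu.ne')).const_sub _).div_const _).congr_deriv ?_
    rw [sub_sub, one_add_one_eq_two]
    field_simp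

lemma continuous_temperedStableExponent (hα : 0 < α) (hl : 0 < l) :
    Continuous (temperedStableExponent α l) := by
  have hsub : Continuous fun u : ℝ => l - u := by fun_prop
  by_cases h1 : α = 1
  · have heq : temperedStableExponent α l =
        fun u => l * ((l - u) / l * Real.log ((l - u) / l)) + u := by
      ext u
      rw [temperedStableExponent, if_pos h1]
      field_simp
    rw [heq]
    exact ((Real.continuous_mul_log.comp (hsub.div_const l)).const_mul l).add continuous_id
  · have heq : temperedStableExponent α l =
        fun u => ((l - u) ^ α - l ^ α) / (α * (α - 1)) + l ^ (α - 1) * u / (α - 1) := by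
      ext u
      rw [temperedStableExponent, if_neg h1]
    have hpow : Continuous fun u : ℝ => (l - u) ^ α := hsub.rpow_const fun _ => Or.inr hα.le
    rw [heq]
    fun_prop

lemma convexOn_temperedStableExponent (hα : 0 < α) (hl : 0 < l) :
    ConvexOn ℝ (Set.Iic l) (temperedStableExponent α l) := by
  refine convexOn_of_hasDerivWithinAt2_nonneg (convex_Iic l)
    (continuous_temperedStableExponent hα hl).continuousOn
    (f' := temperedStableExponentDeriv α l) (f'' := fun u => (l - u) ^ (α - 2))
    (fun u hu => ?_) (fun u hu => ?_) fun u hu => ?_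
  all_goals rw [interior_Iic] at hu
  · exact (hasDerivAt_temperedStableExponent hα hl hu).hasDerivWithinAt
  · exact (hasDerivAt_temperedStableExponentDeriv hl hu).hasDerivWithinAt
  · exact Real.rpow_nonneg (sub_pos.2 hu).le _

variable {lp lm Cp Cm : ℝ}

lemma levyExponent_ctsLevyMeasure (hα0 : 0 < α) (hα2 : α < 2) (hlp : 0 < lp) (hlm : 0 < lm)
    (hCp : 0 ≤ Cp) (hCm : 0 ≤ Cm) (hu : u ∈ Set.Ioo (-lm) lp) :
    levyExponent (ctsLevyMeasure α lp lm Cp Cm) u = Real.Gamma (2 - α) *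
      (Cp * temperedStableExponent α lp u + Cm * temperedStableExponent α lm (-u)) := by
  have hneg {w : ℝ} (hw : w ∈ Set.Ioo (-lm) lp) : -w < lm := neg_lt.1 hw.1
  refine eqOn_levyExponent isOpen_Ioo isPreconnected_Ioo ⟨neg_neg_of_pos hlm, hlp⟩
    (Ioo_subset_levyExpMomentSet_ctsLevyMeasure hα2 hCp hCm) (fun w hw =>
      (((hasDerivAt_temperedStableExponent hα0 hlp hw.2).const_mul Cp).add
        (((hasDerivAt_temperedStableExponent hα0 hlm (hneg hw)).comp w
          (hasDerivAt_neg w)).const_mul Cm)).const_mul (Real.Gamma (2 - α)))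
    (fun w hw => ((((hasDerivAt_temperedStableExponentDeriv hlp hw.2).const_mul Cp).add
        ((((hasDerivAt_temperedStableExponentDeriv hlm (hneg hw)).comp w
          (hasDerivAt_neg w)).mul_const (-1)).const_mul Cm)).const_mul _).congr_deriv ?_)
    (by simp [temperedStableExponent_zero_right, hlp, hlm])
    (by simp [temperedStableExponentDeriv_zero_right, hlp, hlm]) hu
  rw [integral_sq_mul_exp_ctsLevyMeasure hα2 hCp hCm hw]
  ring_nf

lemma PhiH_eq_temperedStableExponent (α lp lm u : ℝ) :
    PhiH α lp lm u = (temperedStableExponent α lp u + temperedStableExponent α lm (-u)) /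
      (lp ^ (α - 2) + lm ^ (α - 2)) := by
  unfold PhiH temperedStableExponent
  split_ifs with h1
  · have hexp : (1 : ℝ) - 2 = -1 := by norm_num
    rw [h1, hexp, Real.rpow_neg_one, Real.rpow_neg_one, sub_neg_eq_add]
    ring
  · rw [sub_neg_eq_add, ← div_div _ _ (lp ^ (α - 2) + lm ^ (α - 2)),
      ← div_div _ _ (lp ^ (α - 2) + lm ^ (α - 2))]
    ring

lemma PhiH_zero_right (hlp : 0 < lp) (hlm : 0 < lm) : PhiH α lp lm 0 = 0 := by
  rw [PhiH_eq_temperedStableExponent, neg_zero, temperedStableExponent_zero_right hlp,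
    temperedStableExponent_zero_right hlm, add_zero, zero_div]

lemma PhiH_neg (α lp lm u : ℝ) : PhiH α lp lm (-u) = PhiH α lm lp u := by
  rw [PhiH_eq_temperedStableExponent, PhiH_eq_temperedStableExponent, neg_neg, add_comm,
    add_comm (lp ^ _)]

lemma continuous_PhiH (hα : 0 < α) (hlp : 0 < lp) (hlm : 0 < lm) :
    Continuous (PhiH α lp lm) := by
  rw [funext (PhiH_eq_temperedStableExponent α lp lm)]
  exact ((continuous_temperedStableExponent hα hlp).add
    ((continuous_temperedStableExponent hα hlm).comp continuous_neg)).div_const _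

lemma convexOn_PhiH (hα : 0 < α) (hlp : 0 < lp) (hlm : 0 < lm) :
    ConvexOn ℝ (Set.Icc (-lm) lp) (PhiH α lp lm) := by
  have hp : ConvexOn ℝ (Set.Icc (-lm) lp) (temperedStableExponent α lp) :=
    (convexOn_temperedStableExponent hα hlp).subset (fun _ h => h.2) (convex_Icc _ _)
  have hm : ConvexOn ℝ (Set.Icc (-lm) lp) fun u => temperedStableExponent α lm (-u) :=
    ((convexOn_temperedStableExponent hα hlm).comp_linearMap (-LinearMap.id)).subset
      (fun _ h => neg_le.1 h.1) (convex_Icc _ _)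
  have hscale : 0 ≤ (lp ^ (α - 2) + lm ^ (α - 2))⁻¹ := by positivity
  refine ((hp.add hm).smul hscale).congr fun u _ => ?_
  exact (inv_mul_eq_div _ _).trans (PhiH_eq_temperedStableExponent α lp lm u).symm

end TemperedStableExponent

noncomputable section StandardizedTemperedStable

open scoped ENNReal Topology

variable {α lp lm : ℝ}

lemma stdCTSConst_pos (hα : α < 2) (hlp : 0 < lp) (hlm : 0 < lm) : 0 < stdCTSConst α lp lm := by
  exact one_div_pos.2 <| mul_pos (Real.Gamma_pos_of_pos (sub_pos.2 hα)) (by positivity)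

lemma stdCTSConst_comm (α lp lm : ℝ) : stdCTSConst α lp lm = stdCTSConst α lm lp := by
  rw [stdCTSConst, stdCTSConst, add_comm]

lemma rpow_mul_stdCTSConst_mul (hlp : 0 < lp) (hlm : 0 < lm) {s : ℝ} (hs : 0 < s) :
    s ^ α * stdCTSConst α (lp * s) (lm * s) = s ^ 2 * stdCTSConst α lp lm := by
  have hpow : s ^ (α - 2) = s ^ α / s ^ 2 := by
    rw [Real.rpow_sub hs, Real.rpow_ofNat]
  unfold stdCTSConst
  rw [Real.mul_rpow hlp.le hs.le, Real.mul_rpow hlm.le hs.le, ← add_mul, hpow]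
  field_simp

/-- The Lévy measure of the standardized tempered stable law `stdCTS(α, lp, lm)`. -/
def stdCTSLevyMeasure (α lp lm : ℝ) : Measure ℝ :=
  ctsLevyMeasure α lp lm (stdCTSConst α lp lm) (stdCTSConst α lp lm)

lemma map_neg_stdCTSLevyMeasure (α lp lm : ℝ) :
    (stdCTSLevyMeasure α lp lm).map (-1 * ·) = stdCTSLevyMeasure α lm lp := by
  rw [stdCTSLevyMeasure, map_neg_ctsLevyMeasure, stdCTSConst_comm, stdCTSLevyMeasure]

lemma map_const_mul_stdCTSLevyMeasure (hlp : 0 < lp) (hlm : 0 < lm) {s : ℝ} (hs : 0 < s) :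
    (stdCTSLevyMeasure α (lp * s) (lm * s)).map (s * ·) =
      ENNReal.ofReal (s ^ 2) • stdCTSLevyMeasure α lp lm := by
  rw [stdCTSLevyMeasure, map_const_mul_ctsLevyMeasure hs, rpow_mul_stdCTSConst_mul hlp hlm hs,
    stdCTSLevyMeasure, smul_ctsLevyMeasure (sq_nonneg s)]

lemma levyExponent_stdCTSLevyMeasure (hα0 : 0 < α) (hα2 : α < 2) (hlp : 0 < lp) (hlm : 0 < lm)
    {u : ℝ} (hu : u ∈ Set.Ioo (-lm) lp) :
    levyExponent (stdCTSLevyMeasure α lp lm) u = PhiH α lp lm u := by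
  have hC := (stdCTSConst_pos hα2 hlp hlm).le
  have hΓ := (Real.Gamma_pos_of_pos (sub_pos.2 hα2)).ne'
  rw [stdCTSLevyMeasure, levyExponent_ctsLevyMeasure hα0 hα2 hlp hlm hC hC hu, stdCTSConst,
    PhiH_eq_temperedStableExponent]
  field_simp

lemma IsMixedTS.exists_isLevyMixture {μ β : ℝ} {F ρ : Measure ℝ} [SFinite F]
    (h : IsMixedTS μ β α lp lm F ρ) (hα : α < 2) (hlp : 0 < lp) (hlm : 0 < lm) :
    ∃ η, IsLevyMixture μ β (stdCTSLevyMeasure α lp lm) F ρ η := by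
  obtain ⟨hpos, κ, hκ, hcts, rfl⟩ := h
  refine ⟨fun v => (κ v).map (√v * ·), hpos, ?_, fun f hf => ?_⟩
  · filter_upwards [hpos, hcts] with v hv hlaw
    have hs : 0 < √v := Real.sqrt_pos.2 hv
    have hC := (stdCTSConst_pos hα (mul_pos hlp hs) (mul_pos hlm hs)).le
    rw [← Real.sq_sqrt hv.le, ← map_const_mul_stdCTSLevyMeasure hlp hlm hs, Real.sq_sqrt hv.le]
    exact (hlaw.isCenteredLevyLaw hα (mul_pos hlp hs) (mul_pos hlm hs) hC hC).map_const_mul √v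
  · rw [lintegral_map hf (by fun_prop), Measure.lintegral_compProd (by fun_prop)]
    refine lintegral_congr fun v => ?_
    rw [lintegral_map (by fun_prop) (by fun_prop)]

end StandardizedTemperedStable

noncomputable section CriticalExponent

open scoped ENNReal Topology

/-- `r` is the largest point of `(0, l]` up to which `G` stays below the level `b`: either the
endpoint `l`, or the only root of `G = b` in `(0, l]`. -/
structure IsCriticalExponent (G : ℝ → ℝ) (b l r : ℝ) : Prop where
  pos : 0 < r
  eq_of_le : G l ≤ b → r = l
  root_of_lt : b < G l → r < l ∧ G r = b
  lt_of_mem_Ioo : ∀ u ∈ Set.Ioo 0 r, G u < b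
  eq_of_root : ∀ u ∈ Set.Ioc 0 l, G u = b → u = r

variable {G : ℝ → ℝ} {b l r : ℝ}

lemma IsCriticalExponent.le (hr : IsCriticalExponent G b l r) : r ≤ l :=
  (le_or_gt (G l) b).elim (fun h => (hr.eq_of_le h).le) fun h => (hr.root_of_lt h).1.le

lemma lt_of_convexOn_of_mem_Ioo {s : Set ℝ} (hG : ConvexOn ℝ s G) {u v w : ℝ} (hu : u ∈ s)
    (hw : w ∈ s) (hGu : G u < b) (hGw : G w ≤ b) (hv : v ∈ Set.Ioo u w) : G v < b := by
  by_contra! hGv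
  have hseg : v ∈ openSegment ℝ u w := by rwa [openSegment_eq_Ioo (hv.1.trans hv.2)]
  exact (hG.lt_right_of_left_lt hu hw hseg (hGu.trans_le hGv)).not_ge (hGw.trans hGv)

lemma exists_isCriticalExponent (hl : 0 < l) (hG : ConvexOn ℝ (Set.Icc 0 l) G)
    (hcont : ContinuousOn G (Set.Icc 0 l)) (hG0 : G 0 < b) :
    ∃ r, IsCriticalExponent G b l r := by
  have hlt {u w : ℝ} (hu : 0 < u) (huw : u < w) (hwl : w ≤ l) (hGw : G w ≤ b) : G u < b :=
    lt_of_convexOn_of_mem_Ioo hG ⟨le_rfl, hl.le⟩ ⟨(hu.trans huw).le, hwl⟩ hG0 hGw ⟨hu, huw⟩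
  rcases le_or_gt (G l) b with hGl | hGl
  · refine ⟨l, hl, fun _ => rfl, fun h => absurd h hGl.not_gt,
      fun u hu => hlt hu.1 hu.2 le_rfl hGl, fun u hu hroot => ?_⟩
    exact hu.2.eq_of_not_lt fun hul => (hlt hu.1 hul le_rfl hGl).ne hroot
  · obtain ⟨r, ⟨hr, hrl⟩, hroot⟩ := intermediate_value_Ioo hl.le hcont ⟨hG0, hGl⟩
    refine ⟨r, hr, fun h => absurd hGl h.not_gt, fun _ => ⟨hrl, hroot⟩,
      fun u hu => hlt hu.1 hu.2 hrl.le hroot.le, fun u hu huroot => ?_⟩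
    rcases lt_trichotomy u r with hur | hur | hru
    · exact absurd huroot (hlt hu.1 hur hrl.le hroot.le).ne
    · exact hur
    · exact absurd hroot (hlt hr hru hu.2 huroot.le).ne

namespace IsLevyMixture

variable {μ β s : ℝ} {N F ρ : Measure ℝ} {η : ℝ → Measure ℝ}

lemma lmgf_ne_top_of_isCriticalExponent (h : IsLevyMixture μ β N F ρ η)
    (hmem : Set.Ioo 0 l ⊆ levyExpMomentSet N) (hF : ∀ c < b, lmgf F c ≠ ∞)
    (hG : ∀ u ∈ Set.Ioo 0 l, G u = β * u + levyExponent N u) (hr : IsCriticalExponent G b l r)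
    {u : ℝ} (hu : u ∈ Set.Ioo 0 r) : lmgf ρ u ≠ ∞ := by
  have hul : u ∈ Set.Ioo 0 l := ⟨hu.1, hu.2.trans_le hr.le⟩
  refine ne_top_of_le_ne_top (ENNReal.mul_ne_top ENNReal.ofReal_ne_top (hF _ ?_))
    (h.lmgf_le (hmem hul))
  rw [← hG u hul]
  exact hr.lt_of_mem_Ioo u hu

lemma decayRateLE_of_isCriticalExponent (h : IsLevyMixture μ β N F ρ η)
    (hs : 0 < s) (hl : 0 < l) (hmem : Set.Ioo (-s) l ⊆ levyExpMomentSet N)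
    (hN : DecayRateLE (fun x => N (Set.Ioi x)) l) (hb : 0 < b)
    (hF : DecayRateLE (fun w => F (Set.Icc w (w + 1))) b)
    (hG : ∀ u ∈ Set.Ioo 0 l, G u = β * u + levyExponent N u) (hr : IsCriticalExponent G b l r) :
    DecayRateLE (fun x => ρ (Set.Ici x)) r := by
  have h0 : 0 ∈ levyExpMomentSet N := hmem ⟨neg_neg_of_pos hs, hl⟩
  rcases le_or_gt (G l) b with hGl | hGl
  · obtain ⟨w, hFw, hw⟩ := ((hF (b + 1) (lt_add_one b)).and (eventually_gt_atTop 0)).exists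
    have hFw_ne : F (Set.Icc w (w + 1)) ≠ 0 :=
      ((ENNReal.ofReal_pos.2 (Real.exp_pos _)).trans_le hFw).ne'
    rw [hr.eq_of_le hGl]
    exact h.decayRateLE_of_decayRateLE_levyMeasure h0 (half_pos hs)
      (hmem ⟨by linarith, by linarith⟩) hw hFw_ne hN
  · obtain ⟨hrl, hroot⟩ := hr.root_of_lt hGl
    have hrmem : r ∈ interior (levyExpMomentSet N) :=
      interior_maximal hmem isOpen_Ioo ⟨by linarith [hr.pos], hrl⟩
    exact h.decayRateLE_of_root h0 hb hr.pos hrmem ((hG r ⟨hr.pos, hrl⟩).symm.trans hroot) hF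

end IsLevyMixture

lemma exists_isCriticalExponent_add_PhiH {α lp lm β : ℝ} (hα : 0 < α) (hlp : 0 < lp) (hlm : 0 < lm)
    (hb : 0 < b) : ∃ r, IsCriticalExponent (fun u => β * u + PhiH α lp lm u) b lp r := by
  refine exists_isCriticalExponent hlp (ConvexOn.add
    ((LinearMap.mulLeft ℝ β).convexOn (convex_Icc _ _)) ((convexOn_PhiH hα hlp hlm).subset
    (Set.Icc_subset_Icc_left (neg_nonpos.2 hlm.le)) (convex_Icc _ _))) ?_ ?_
  · exact ((continuous_const_mul β).add (continuous_PhiH hα hlp hlm)).continuousOn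
  · simpa [PhiH_zero_right hlp hlm] using hb

lemma IsLevyMixture.exists_isCriticalExponent {μ β α lp lm a : ℝ} {ρ : Measure ℝ}
    {η : ℝ → Measure ℝ}
    (h : IsLevyMixture μ β (stdCTSLevyMeasure α lp lm) (gammaMeasure a b) ρ η) (hα0 : 0 < α)
    (hα2 : α < 2) (hlp : 0 < lp) (hlm : 0 < lm) (ha : 0 < a) (hb : 0 < b) :
    ∃ r, IsCriticalExponent (fun u => β * u + PhiH α lp lm u) b lp r ∧
      (∀ u ∈ Set.Ioo 0 r, lmgf ρ u ≠ ∞) ∧ DecayRateLE (fun x => ρ (Set.Ici x)) r := by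
  have := isProbabilityMeasure_gammaMeasure ha hb
  obtain ⟨r, hr⟩ := exists_isCriticalExponent_add_PhiH (β := β) hα0 hlp hlm hb
  have hC := stdCTSConst_pos hα2 hlp hlm
  have hmem : Set.Ioo (-lm) lp ⊆ levyExpMomentSet (stdCTSLevyMeasure α lp lm) :=
    Ioo_subset_levyExpMomentSet_ctsLevyMeasure hα2 hC.le hC.le
  have hmem_pos : Set.Ioo 0 lp ⊆ Set.Ioo (-lm) lp :=
    Set.Ioo_subset_Ioo_left (neg_nonpos.2 hlm.le)
  have hG : ∀ u ∈ Set.Ioo 0 lp, β * u + PhiH α lp lm u =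
      β * u + levyExponent (stdCTSLevyMeasure α lp lm) u := fun u hu => by
    rw [levyExponent_stdCTSLevyMeasure hα0 hα2 hlp hlm (hmem_pos hu)]
  refine ⟨r, hr, fun u hu => h.lmgf_ne_top_of_isCriticalExponent (hmem_pos.trans hmem)
    (fun c hc => ?_) hG hr hu, h.decayRateLE_of_isCriticalExponent hlm hlp hmem
    (decayRateLE_ctsLevyMeasure_Ioi _ _ _ _ hC) hb (decayRateLE_gammaMeasure_Icc ha hb) hG hr⟩
  exact (lmgf_gammaMeasure ha hb hc).trans_ne ENNReal.ofReal_ne_top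

end CriticalExponent

theorem mainTheorem2 {Ω : Type*} [MeasurableSpace Ω] (P : Measure Ω) [IsProbabilityMeasure P]
    (Y : Ω → ℝ) (hY : AEMeasurable Y P)
    (μ β α lp lm a b : ℝ) (hα0 : 0 < α) (hα2 : α < 2) (hlp : 0 < lp) (hlm : 0 < lm)
    (ha : 0 < a) (hb : 0 < b)
    (hlaw : IsMixedTS μ β α lp lm (gammaMeasure a b) (P.map Y)) :
    ∃ r q : ℝ, 0 < r ∧ 0 < q ∧
      -- `r` and `-q` are the critical exponents of the moment generating function
      IsLUB {u : ℝ | Integrable (fun ω => Real.exp (u * Y ω)) P} r ∧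
      IsGLB {u : ℝ | Integrable (fun ω => Real.exp (u * Y ω)) P} (-q) ∧
      -- identification of `r` as `lp` or the root `u₊`
      (β * lp + PhiH α lp lm lp ≤ b → r = lp) ∧
      (b < β * lp + PhiH α lp lm lp → r < lp ∧ β * r + PhiH α lp lm r = b) ∧
      -- identification of `q` as `lm`, or of `-q` as the root `u₋`
      (-β * lm + PhiH α lp lm (-lm) ≤ b → q = lm) ∧
      (b < -β * lm + PhiH α lp lm (-lm) → q < lm ∧ β * (-q) + PhiH α lp lm (-q) = b) ∧
      -- there is no other root
      (∀ u ∈ Set.Icc (-lm) lp, β * u + PhiH α lp lm u = b → u = r ∨ u = -q) ∧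
      -- logarithmic tail asymptotics
      (fun x : ℝ => Real.log (P.real {ω | x < Y ω})) ~[atTop] (fun x : ℝ => -r * x) ∧
      (fun x : ℝ => Real.log (P.real {ω | Y ω ≤ -x})) ~[atTop] (fun x : ℝ => -q * x) := by
  have := isProbabilityMeasure_gammaMeasure ha hb
  obtain ⟨η, hη⟩ := hlaw.exists_isLevyMixture hα2 hlp hlm
  have hη_neg := hη.neg
  rw [map_neg_stdCTSLevyMeasure] at hη_neg
  obtain ⟨r, hr, hr_fin, hr_rate⟩ := hη.exists_isCriticalExponent hα0 hα2 hlp hlm ha hb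
  obtain ⟨q, hq, hq_fin, hq_rate⟩ := hη_neg.exists_isCriticalExponent hα0 hα2 hlm hlp ha hb
  simp only [← lmgf_map_ne_top_iff_integrable hY]
  refine ⟨r, q, hr.pos, hq.pos, isLUB_lmgf_ne_top hr.pos hr_fin hr_rate,
    isGLB_lmgf_ne_top hq.pos hq_fin hq_rate, hr.eq_of_le, hr.root_of_lt, ?_, ?_,
    fun u hu hroot => ?_, isEquivalent_log_measure_lt hY hr.pos hr_fin hr_rate,
    isEquivalent_log_measure_le_neg hY hq.pos hq_fin hq_rate⟩
  · rw [PhiH_neg]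
    exact hq.eq_of_le
  · rw [PhiH_neg, PhiH_neg, mul_neg, ← neg_mul]
    exact hq.root_of_lt
  · rcases lt_trichotomy u 0 with hneg | rfl | hpos
    · refine .inr (neg_eq_iff_eq_neg.1 (hq.eq_of_root (-u) ⟨neg_pos.2 hneg, neg_le.1 hu.1⟩ ?_))
      rwa [PhiH_neg, neg_mul_neg]
    · simp [PhiH_zero_right hlp hlm, hb.ne] at hroot
    · exact .inl (hr.eq_of_root u ⟨hpos, hu.2⟩ hroot)
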